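/- Euler sums. For positive integers $s_1,\dots,s_d$ and signs $z_1,\dots,z_d\in\{\pm1\}$ let $$\zeta^{(M)}(s_1,\dots,s_d;z_1,\dots,z_d)=\sum_{M\ge n_1>\cdots>n_d>0}\frac{z_1^{n_1}\cdots z_d^{n_d}}{n_1^{s_1}\cdots n_d^{s_d}},\qquad I^{(\varepsilon)}(s_1,\dots,s_d;z_1,\dots,z_d)=\int_0^{1-\varepsilon}\Big(\frac{dt}{t}\Big)^{s_1-1}\frac{dt}{a_1-t}\cdots\Big(\frac{dt}{t}\Big)^{s_d-1}\frac{dt}{a_d-t},$$ an iterated integral over $1-\varepsilon>t_1>t_2>\cdots>0$ with $a_k=z_1\cdots z_k$. If $(s_1,z_1)\neq(1,1)$ the index is called admissible, and $\zeta(s_1,\dots,s_d;z_1,\dots,z_d)=\lim_{M\to\infty}\zeta^{(M)}$. For every index let $\zeta_*$ and $\zeta_{\mathrm{sh}}$ be its stuffle and shuffle regularizations, i.e. the unique polynomials in $\mathbb R[T]$ such that $$\zeta^{(M)}=\zeta_*(\log M+\gamma)+o(1)\quad(M\to\infty),\qquad I^{(\varepsilon)}=\zeta_{\mathrm{sh}}(-\log\varepsilon)+o(1)\quad(\varepsilon\to0^+),$$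 where $\gamma$ is Euler's constant. A bar over $s_j$ means $z_j=-1$, no bar means $z_j=1$. Theorem. For every index of depth $d\le 3$ the polynomials $\zeta_*$ and $\zeta_{\mathrm{sh}}$ exist, and for every admissible index of depth $d\le3$ the limit $\zeta$ exists. Let $w\ge4$, $u=w-2$, $v=w-1$, and let $\sum$ denote the sum over all pairs of positive integers $(b,c)$ with $b+c=w-1$. Then (as identities in $\mathbb R[T]$ where regularized values occur) \begin{align*} \sum\zeta_{\mathrm{sh}}(1,b,c)&=\zeta(2,u)+\zeta_*(1,v)+\zeta_*(1,1,u)-\tfrac12\zeta(2)\zeta(u),\\ \sum\zeta_{\mathrm{sh}}(1,\bar b,c)&=\zeta(\bar2,\bar u)+\zeta_*(1,v)+\zeta_*(1,\bar1,\bar u)+\zeta_*(1,\bar u,\bar1)+\zeta(\bar1,1,\bar u)-\zeta(\bar1,\bar1,\bar u)-\zeta_*(1,\bar u,1),\\ \sum\zeta(\bar1,b,c)&=\zeta(2,u)+\zeta(\bar1,\bar v)+\zeta(\bar1,u,\bar1)+2\zeta(\bar1,\bar1,u)-\zeta(\bar1,1,u)-\zeta(\bar1,u,1),\\ \sum\zeta(\bar1,\bar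 b,c)&=\zeta(\bar2,\bar u)+\zeta(\bar1,\bar v)+\zeta(\bar1,1,\bar u),\\ \sum\zeta(\bar1,\bar b,\bar c)&=\zeta(\bar2,u)+\zeta(\bar1,v)+\zeta(\bar1,u,1)+\zeta(\bar1,1,u)-\zeta(\bar1,u,\bar1),\\ \sum\zeta_{\mathrm{sh}}(1,b,\bar c)&=\zeta(2,\bar u)+\zeta_*(1,\bar v)+\zeta_*(1,\bar u,1)+\zeta_*(1,1,\bar u)-\zeta_{\mathrm{sh}}(1,\bar u,\bar1)-\tfrac12\zeta(2)\zeta(\bar u),\\ \sum\zeta_{\mathrm{sh}}(1,\bar b,\bar c)&=\zeta(\bar2,u)+\zeta_*(1,\bar v)+\zeta_*(1,\bar1,u)+\zeta(\bar1,1,u)-\zeta(\bar1,\bar1,u),\\ \sum\zeta(\bar1,b,\bar c)&=\zeta(2,\bar u)+\zeta(\bar1,v)+2\zeta(\bar1,\bar1,\bar u)-\zeta(\bar1,1,\bar u). \end{align*} -/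

import Mathlib

open Filter Topology Polynomial

noncomputable section

namespace EulerSums

/-- A signed entry `(s, z)`: an exponent `s` together with a sign `z = ±1`. -/
abbrev Entry := ℕ × ℤˣ

/-- The entry `n` without a bar, i.e. exponent `n` and sign `1`. -/
def pos (n : ℕ) : Entry := (n, 1)

/-- The entry `n` with a bar, i.e. exponent `n` and sign `-1`. -/
def bar (n : ℕ) : Entry := (n, -1)

/-- All exponents are positive integers. -/
def IsIndex (l : List Entry) : Prop := ∀ e ∈ l, 1 ≤ e.1

/-- A nonempty index is admissible if its first entry is not `(1, 1)`. -/
def IsAdmissible (l : List Entry) : Prop := IsIndex l ∧ l ≠ [] ∧ l.head? ≠ some (pos 1)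

/-- The truncated Euler sum
`ζ^(M)(s; z) = ∑_{M ≥ n₁ > n₂ > ⋯ > n_d > 0} ∏ⱼ zⱼ ^ nⱼ / nⱼ ^ sⱼ`, summed from the outermost
variable `n₁` inwards. -/
def truncSum : List Entry → ℕ → ℝ
  | [], _ => 1
  | (s, z) :: l, M =>
      ∑ n ∈ Finset.Icc 1 M, (((z : ℤ) : ℝ) ^ n / (n : ℝ) ^ s) * truncSum l (n - 1)

/-- The Euler sum `ζ(s; z)`, the limit of its truncations as `M → ∞`. -/
def eulerSum (l : List Entry) : ℝ := limUnder atTop (truncSum l)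

/-- The iterated integral
`∫_{x > t₁ > t₂ > ⋯ > 0} f₁(t₁) f₂(t₂) ⋯ dt₁ dt₂ ⋯` of a list of densities. -/
def iterInt : List (ℝ → ℝ) → ℝ → ℝ
  | [], _ => 1
  | f :: fs, x => ∫ t in (0 : ℝ)..x, f t * iterInt fs t

/-- The densities of the word `(dt/t)^(s₁-1) dt/(a₁-t) ⋯ (dt/t)^(s_d-1) dt/(a_d-t)`, where
`a_k = a * z₁ ⋯ z_k`. -/
def forms : ℤˣ → List Entry → List (ℝ → ℝ)
  | _, [] => []
  | a, (s, z) :: l =>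
      List.replicate (s - 1) (fun t : ℝ => 1 / t) ++
        (fun t : ℝ => 1 / ((((a * z : ℤˣ) : ℤ) : ℝ) - t)) :: forms (a * z) l

/-- The truncated iterated integral `I^(ε)(s; z)`, over `[0, 1 - ε]`. Since the signs are `±1`,
the partial products of the `zⱼ` and of the `zⱼ⁻¹` agree. -/
def truncInt (l : List Entry) (ε : ℝ) : ℝ := iterInt (forms 1 l) (1 - ε)

/-- `P` is the stuffle regularization of the index: `ζ^(M)(s; z) = P(log M + γ) + o(1)`
as `M → ∞`, where `γ` is Euler's constant. -/
def IsStuffleReg (l : List Entry) (P : ℝ[X]) : Prop :=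
  Tendsto (fun M : ℕ => truncSum l M - P.eval (Real.log M + Real.eulerMascheroniConstant))
    atTop (𝓝 0)

/-- `P` is the shuffle regularization of the index: `I^(ε)(s; z) = P(-log ε) + o(1)`
as `ε → 0⁺`. -/
def IsShuffleReg (l : List Entry) (P : ℝ[X]) : Prop :=
  Tendsto (fun ε : ℝ => truncInt l ε - P.eval (-Real.log ε)) (𝓝[>] 0) (𝓝 0)

/-- A polynomial that tends to zero along a path going to infinity is zero. -/
theorem eq_zero_of_tendsto {α : Type*} {l : Filter α} [l.NeBot] {x : α → ℝ}
    (hx : Tendsto x l atTop) {R : ℝ[X]} (h : Tendsto (fun i => R.eval (x i)) l (𝓝 0)) :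
    R = 0 := by
  by_cases hd : 0 < R.degree
  · have h1 := (R.abs_tendsto_atTop hd).comp hx
    have h2 := h.abs
    exact absurd h2 (not_tendsto_nhds_of_tendsto_atTop h1 _)
  · rw [Polynomial.eq_C_of_degree_le_zero (not_lt.mp hd)] at h ⊢
    simp only [Polynomial.eval_C] at h
    rw [tendsto_nhds_unique tendsto_const_nhds h, Polynomial.C_0]

/-- The stuffle regularization is unique. -/
theorem IsStuffleReg.unique {l : List Entry} {P Q : ℝ[X]} (hP : IsStuffleReg l P)
    (hQ : IsStuffleReg l Q) : P = Q := by
  have hx : Tendsto (fun M : ℕ => Real.log M + Real.eulerMascheroniConstant) atTop atTop :=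
    tendsto_atTop_add_const_right _ _ (Real.tendsto_log_atTop.comp tendsto_natCast_atTop_atTop)
  refine sub_eq_zero.mp (eq_zero_of_tendsto hx ?_)
  have h := hQ.sub hP
  simpa using h

/-- The shuffle regularization is unique. -/
theorem IsShuffleReg.unique {l : List Entry} {P Q : ℝ[X]} (hP : IsShuffleReg l P)
    (hQ : IsShuffleReg l Q) : P = Q := by
  have hx : Tendsto (fun ε : ℝ => -Real.log ε) (𝓝[>] 0) atTop :=
    tendsto_neg_atBot_atTop.comp Real.tendsto_log_nhdsGT_zero
  refine sub_eq_zero.mp (eq_zero_of_tendsto hx ?_)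
  have h := hQ.sub hP
  simpa using h

open Classical in
/-- The stuffle-regularized Euler sum `ζ_*(s; z)`, a polynomial in `T`: the unique polynomial
`P` with `ζ^(M)(s; z) = P(log M + γ) + o(1)`. -/
def zetaStar (l : List Entry) : ℝ[X] :=
  if h : ∃ P, IsStuffleReg l P then h.choose else 0

open Classical in
/-- The shuffle-regularized Euler sum `ζ_ш(s; z)`, a polynomial in `T`: the unique polynomial
`P` with `I^(ε)(s; z) = P(-log ε) + o(1)`. -/
def zetaSha (l : List Entry) : ℝ[X] :=
  if h : ∃ P, IsShuffleReg l P then h.choose else 0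

/-- The pairs `(b, c)` of positive integers with `b + c = n`. -/
def pairs (n : ℕ) : Finset (ℕ × ℕ) :=
  (Finset.HasAntidiagonal.antidiagonal n).filter (fun p => 1 ≤ p.1 ∧ 1 ≤ p.2)

end EulerSums

end

open EulerSums

/-! The formulas are regularized double shuffle relations for the product of `(1; q)` with `(1, u;
p, p * r)`; the eight cases are the eight choices of signs `p`, `q`, `r`.

On the integral side, shuffling the letter `dt/(q - t)` into the word `dt/(p - t) (dt/t)^(u-1) dt/(r
- t)` puts it in every position. The interior positions give exactly the sum over `(b, c)`, and the
first and last positions give two extra words (`wordSeries_sum_formula`, `sum_zetaSha`). On the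
series side, the same product expands into five truncated sums (`truncSum_stuffle_one_two`,
`zetaStar_stuffle`). Equating the two expansions gives `sum_zetaSha_eq`, once the two
regularizations are compared.

The comparison rests on one expansion: every truncated sum is a linear combination of the
truncations of `ζ(1, …, 1)` up to `O(n ^ (-1/2))` (`exists_hasExpansion`). The coefficients of the
power series for the iterated integral are the increments of the truncated sum
(`coeff_wordSeries_word`), so Abel summation carries the same combination over to the integrals with
an error `O(ε ^ (1/4))` (`abs_le_of_abs_sum_le`). The two regularizations therefore differ only in
the polynomial attached to `ζ(1, …, 1)`: `T ^ k / k!` for shuffle (`truncInt_ones`), and the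
Newton-type polynomials `onesPoly` for stuffle. These agree for `k ≤ 1` and differ by `ζ(2) / 2` for
`k = 2`, which is the source of the products with `ζ(2)`. -/

namespace EulerSums

/-! ### Truncated sums and their increments -/

/-- The increments of the truncated sums: the coefficients of the power series whose
value at `1 - ε` is the truncated iterated integral. -/
noncomputable def coef : List Entry → ℕ → ℝ
  | [], n => if n = 0 then 1 else 0
  | (s, z) :: l, n => if n = 0 then 0 else ((z : ℤ) : ℝ) ^ n / (n : ℝ) ^ s * truncSum l (n - 1)

theorem coef_cons_zero (e : Entry) (l : List Entry) : coef (e :: l) 0 = 0 := by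
  simp [coef]

theorem coef_cons_succ (s : ℕ) (z : ℤˣ) (l : List Entry) (n : ℕ) :
    coef ((s, z) :: l) (n + 1) =
      ((z : ℤ) : ℝ) ^ (n + 1) / ((n : ℝ) + 1) ^ s * truncSum l n := by
  simp [coef]

theorem truncSum_zero (l : List Entry) : truncSum l 0 = coef l 0 := by
  rcases l with _ | ⟨⟨s, z⟩, l⟩ <;> simp [truncSum, coef]

theorem truncSum_succ (l : List Entry) (M : ℕ) :
    truncSum l (M + 1) = truncSum l M + coef l (M + 1) := by
  rcases l with _ | ⟨⟨s, z⟩, l⟩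
  · simp [truncSum, coef]
  · rw [truncSum, truncSum, Finset.sum_Icc_succ_top (by omega)]
    simp [coef]

theorem sum_range_coef (l : List Entry) (M : ℕ) :
    ∑ n ∈ Finset.range (M + 1), coef l n = truncSum l M := by
  induction M with
  | zero => simp [truncSum_zero]
  | succ M ih => rw [Finset.sum_range_succ, ih, truncSum_succ]

/-! ### Words and formal iterated integrals -/

/-- The density of a letter: `none` stands for `dt/t` and `some a` for `dt/(a - t)`. -/
noncomputable def letterForm : Option ℤˣ → ℝ → ℝ
  | none => fun t => 1 / t
  | some a => fun t => 1 / (((a : ℤ) : ℝ) - t)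

/-- The word of letters of an index. -/
def word : ℤˣ → List Entry → List (Option ℤˣ)
  | _, [] => []
  | a, (s, z) :: l => List.replicate (s - 1) none ++ some (a * z) :: word (a * z) l

theorem forms_eq_map_word (a : ℤˣ) (l : List Entry) : forms a l = (word a l).map letterForm := by
  induction l generalizing a with
  | nil => rfl
  | cons e l ih =>
    obtain ⟨s, z⟩ := e
    simp [forms, word, ih, letterForm]

/-- The power series of `1 / (a - t)` for a sign `a`. -/
noncomputable def gen (a : ℤˣ) : PowerSeries ℝ := PowerSeries.mk fun k => ((a : ℤ) : ℝ) ^ (k + 1)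

/-- The primitive without constant term. -/
noncomputable def formalInt (f : PowerSeries ℝ) : PowerSeries ℝ :=
  PowerSeries.mk fun n => PowerSeries.coeff (n - 1) f / n

/-- The formal iterated integral of a word. -/
noncomputable def wordSeries : List (Option ℤˣ) → PowerSeries ℝ
  | [] => 1
  | none :: w => PowerSeries.mk fun n => PowerSeries.coeff n (wordSeries w) / n
  | some a :: w => formalInt (gen a * wordSeries w)

open PowerSeries (derivative constantCoeff coeff)

theorem derivative_formalInt (f : PowerSeries ℝ) : derivative ℝ (formalInt f) = f := by
  ext n
  rw [PowerSeries.coeff_derivative, formalInt, PowerSeries.coeff_mk]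
  have : (n : ℝ) + 1 ≠ 0 := by positivity
  push_cast
  field_simp

theorem constantCoeff_wordSeries_cons (x : Option ℤˣ) (w : List (Option ℤˣ)) :
    constantCoeff (wordSeries (x :: w)) = 0 := by
  rw [← PowerSeries.coeff_zero_eq_constantCoeff_apply]
  cases x <;> simp [wordSeries, formalInt]

theorem derivative_wordSeries_some (a : ℤˣ) (w : List (Option ℤˣ)) :
    derivative ℝ (wordSeries (some a :: w)) = gen a * wordSeries w :=
  derivative_formalInt _

/-- The vanishing constant term is essential: division by `n = 0` discards it in the formal
primitive for `dt/t`. -/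
theorem X_mul_derivative_wordSeries_none (w : List (Option ℤˣ))
    (h : constantCoeff (wordSeries w) = 0) :
    PowerSeries.X * derivative ℝ (wordSeries (none :: w)) = wordSeries w := by
  ext n
  rcases n with _ | n
  · simp [h]
  · rw [PowerSeries.coeff_succ_X_mul, PowerSeries.coeff_derivative, wordSeries,
      PowerSeries.coeff_mk]
    have : (n : ℝ) + 1 ≠ 0 := by positivity
    push_cast
    field_simp

/-- The form `dt/t` is not a power series, so its product rule is checked after multiplication by
`X`, which is cancellable. -/
theorem ext_of_X_mul_derivative {f g : PowerSeries ℝ}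
    (h : PowerSeries.X * derivative ℝ f = PowerSeries.X * derivative ℝ g)
    (hc : constantCoeff f = constantCoeff g) : f = g :=
  PowerSeries.derivative.ext (mul_left_cancel₀ PowerSeries.X_ne_zero h) hc

/-- The shuffle product of the letter `dt/(q - t)` with the word `(dt/t)^k dt/(r - t)`. -/
theorem wordSeries_shuffle_replicate (q r : ℤˣ) (k : ℕ) :
    wordSeries [some q] * wordSeries (List.replicate k none ++ [some r]) =
      ∑ i ∈ Finset.range (k + 1),
        wordSeries (List.replicate i none ++ some q :: (List.replicate (k - i) none ++ [some r]))
      + wordSeries (List.replicate k none ++ [some r, some q]) := by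
  have hone : wordSeries [] = 1 := rfl
  induction k with
  | zero =>
    refine PowerSeries.derivative.ext ?_ ?_
    · simp only [Derivation.leibniz, smul_eq_mul, List.replicate_zero, List.nil_append,
        derivative_wordSeries_some, hone, Finset.range_one, Finset.sum_singleton, map_add,
        zero_add]
      simp only [Nat.sub_zero, List.replicate_zero, List.nil_append]
      ring
    · simp [constantCoeff_wordSeries_cons]
  | succ k ih =>
    have hc : ∀ (m : ℕ) (x : Option ℤˣ) (w : List (Option ℤˣ)),
        constantCoeff (wordSeries (List.replicate m none ++ x :: w)) = 0 := by
      intro m x w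
      cases m
      · exact constantCoeff_wordSeries_cons _ _
      · exact constantCoeff_wordSeries_cons _ _
    refine ext_of_X_mul_derivative ?_ ?_
    -- Of the two product-rule terms, one is the `i = 0` word, which starts with `q`; the other is
    -- the induction hypothesis, whose words reappear after the leading `dt/t` is stripped.
    · rw [Finset.sum_range_succ', Derivation.leibniz, map_add, map_add, map_sum]
      simp only [smul_eq_mul, mul_add, Finset.mul_sum, List.replicate_succ, List.cons_append,
        List.replicate_zero, List.nil_append, derivative_wordSeries_some, hone, mul_one,
        Nat.sub_zero, Nat.add_sub_add_right]
      rw [mul_left_comm, X_mul_derivative_wordSeries_none _ (hc _ _ _), ih,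
        X_mul_derivative_wordSeries_none _ (hc _ _ _),
        Finset.sum_congr rfl fun i _ => X_mul_derivative_wordSeries_none _ (hc _ _ _)]
      ring
    · simp [hc, constantCoeff_wordSeries_cons]

/-- The sum formula for words, from the shuffle product. -/
theorem wordSeries_sum_formula (p q r : ℤˣ) (k : ℕ) :
    wordSeries [some q] * wordSeries (some p :: (List.replicate k none ++ [some r])) =
      ∑ i ∈ Finset.range (k + 1), wordSeries
        (some p :: (List.replicate i none ++ some q :: (List.replicate (k - i) none ++ [some r])))
      + wordSeries (some p :: (List.replicate k none ++ [some r, some q]))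
      + wordSeries (some q :: some p :: (List.replicate k none ++ [some r])) := by
  have hone : wordSeries [] = 1 := rfl
  refine PowerSeries.derivative.ext ?_ ?_
  · have h := wordSeries_shuffle_replicate q r k
    rw [Derivation.leibniz, map_add, map_add, map_sum]
    simp only [derivative_wordSeries_some, smul_eq_mul, hone, ← Finset.mul_sum]
    -- The product rule splits the words by first letter: those starting with `p` are `gen p` times
    -- the shuffle of `q` with the tail, and the one starting with `q` matches the other term.
    linear_combination gen p * h
  · simp [constantCoeff_wordSeries_cons]

/-- Multiplication by a geometric series takes partial sums; the powers of `a` in the two factors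
combine to `a ^ (n + 1)`. -/
theorem coeff_gen_mul (a : ℤˣ) (c : ℕ → ℝ) (f : PowerSeries ℝ)
    (h : ∀ n, coeff n f = ((a : ℤ) : ℝ) ^ n * c n) (n : ℕ) :
    coeff n (gen a * f) = ((a : ℤ) : ℝ) ^ (n + 1) * ∑ k ∈ Finset.range (n + 1), c k := by
  rw [PowerSeries.coeff_mul, Finset.Nat.sum_antidiagonal_eq_sum_range_succ_mk, Finset.mul_sum,
    ← Finset.sum_range_reflect]
  refine Finset.sum_congr rfl fun k hk => ?_
  have hk' : k ≤ n := by simpa [Nat.lt_succ_iff] using hk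
  have h1 : n - (n + 1 - 1 - k) = k := by omega
  simp only [h1, gen, PowerSeries.coeff_mk, h]
  rw [← mul_assoc, ← pow_add]
  congr 2
  omega

theorem coeff_wordSeries_replicate (k n : ℕ) (w : List (Option ℤˣ)) :
    coeff n (wordSeries (List.replicate k none ++ w)) = coeff n (wordSeries w) / (n : ℝ) ^ k := by
  induction k with
  | zero => simp
  | succ k ih =>
    rw [List.replicate_succ, List.cons_append, wordSeries, PowerSeries.coeff_mk, ih, div_div,
      ← pow_succ]

/-- The bridge between integrals and sums: each `dt/(a_k - t)` sums the coefficients and divides by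
`n`, and each `dt/t` divides by `n` once more. Letters carry the products `a_k`, so the sign `z` of
an entry is what remains after factoring out `a ^ n`. -/
theorem coeff_wordSeries_word (a : ℤˣ) (l : List Entry) (hl : IsIndex l) (n : ℕ) :
    coeff n (wordSeries (word a l)) = ((a : ℤ) : ℝ) ^ n * coef l n := by
  induction l generalizing a n with
  | nil =>
    simp only [word, wordSeries, coef, PowerSeries.coeff_one]
    split_ifs with h <;> simp [h]
  | cons e l ih =>
    obtain ⟨s, z⟩ := e
    have hs : 1 ≤ s := hl (s, z) (by simp)
    have hl' : IsIndex l := fun e he => hl e (by simp [he])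
    rw [word, coeff_wordSeries_replicate, wordSeries, formalInt, PowerSeries.coeff_mk]
    rcases n with _ | n
    · simp [coef]
    · rw [Nat.add_sub_cancel, coeff_gen_mul _ (coef l) _ (fun n => ih (a * z) hl' n),
        sum_range_coef, coef_cons_succ]
      obtain ⟨t, rfl⟩ : ∃ t, s = t + 1 := ⟨s - 1, by omega⟩
      have : (n : ℝ) + 1 ≠ 0 := by positivity
      push_cast
      rw [mul_pow, pow_succ ((n : ℝ) + 1) t]
      field_simp

/-! ### Values of power series on `[0, 1)` -/

/-- The power series `f` converges absolutely on `[0, 1)`, to the function `F`. -/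
def HasValue (f : PowerSeries ℝ) (F : ℝ → ℝ) : Prop :=
  ∀ x ∈ Set.Ico (0 : ℝ) 1, (Summable fun n => |coeff n f * x ^ n|) ∧
    HasSum (fun n => coeff n f * x ^ n) (F x)

theorem HasValue.mul {f g : PowerSeries ℝ} {F G : ℝ → ℝ} (hf : HasValue f F)
    (hg : HasValue g G) : HasValue (f * g) fun x => F x * G x := by
  intro x hx
  obtain ⟨h1, h2⟩ := hf x hx
  obtain ⟨h3, h4⟩ := hg x hx
  have key : ∀ n, coeff n (f * g) * x ^ n = ∑ kl ∈ Finset.HasAntidiagonal.antidiagonal n,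
      (coeff kl.1 f * x ^ kl.1) * (coeff kl.2 g * x ^ kl.2) := by
    intro n
    rw [PowerSeries.coeff_mul, Finset.sum_mul]
    refine Finset.sum_congr rfl fun kl hkl => ?_
    rw [← Finset.HasAntidiagonal.mem_antidiagonal.mp hkl, pow_add]
    ring
  simp only [key]
  have hs := summable_norm_sum_mul_antidiagonal_of_summable_norm
    (f := fun n => coeff n f * x ^ n) (g := fun n => coeff n g * x ^ n) h1 h3
  refine ⟨hs, ?_⟩
  rw [← h2.tsum_eq, ← h4.tsum_eq,
    tsum_mul_tsum_eq_tsum_sum_antidiagonal_of_summable_norm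
      (f := fun n => coeff n f * x ^ n) (g := fun n => coeff n g * x ^ n) h1 h3]
  exact hs.of_norm.hasSum

theorem hasValue_gen (a : ℤˣ) : HasValue (gen a) (letterForm (some a)) := by
  intro x hx
  have ha : ((a : ℤ) : ℝ) * ((a : ℤ) : ℝ) = 1 := by
    rcases Int.units_eq_one_or a with rfl | rfl <;> simp
  have habs : |((a : ℤ) : ℝ)| = 1 := by
    rcases Int.units_eq_one_or a with rfl | rfl <;> simp
  have hax : |((a : ℤ) : ℝ) * x| < 1 := by
    rw [abs_mul, habs, one_mul, abs_of_nonneg hx.1]; exact hx.2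
  have hne : ((a : ℤ) : ℝ) - x ≠ 0 := by
    intro h
    rw [← sub_eq_zero.mp h, ha] at hax
    norm_num at hax
  have hne' : 1 - ((a : ℤ) : ℝ) * x ≠ 0 := by
    intro h
    rw [← sub_eq_zero.mp h] at hax
    norm_num at hax
  have key : ∀ n, coeff n (gen a) * x ^ n = ((a : ℤ) : ℝ) * (((a : ℤ) : ℝ) * x) ^ n := by
    intro n
    rw [gen, PowerSeries.coeff_mk, mul_pow]
    ring
  simp only [key]
  constructor
  · simp only [abs_mul, abs_pow, habs, one_mul] at hax ⊢
    exact summable_geometric_of_lt_one (abs_nonneg _) hax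
  · have h : letterForm (some a) x = ((a : ℤ) : ℝ) * (1 - ((a : ℤ) : ℝ) * x)⁻¹ := by
      change 1 / (((a : ℤ) : ℝ) - x) = _
      field_simp
      linear_combination -ha
    rw [h]
    exact (hasSum_geometric_of_abs_lt_one hax).mul_left _

/-- Termwise integration of a power series. -/
theorem hasSum_integral_of_hasSum {d : ℕ → ℝ} {g : ℝ → ℝ}
    (h : ∀ x ∈ Set.Ioo (0 : ℝ) 1, (Summable fun n => |d n * x ^ n|) ∧
      HasSum (fun n => d n * x ^ n) (g x)) {x : ℝ} (hx : x ∈ Set.Ioo (0 : ℝ) 1) :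
    HasSum (fun n => d n * x ^ (n + 1) / (n + 1)) (∫ t in (0 : ℝ)..x, g t) := by
  have hint : ∀ n : ℕ, ∫ t in (0 : ℝ)..x, d n * t ^ n = d n * x ^ (n + 1) / (n + 1) := by
    intro n
    rw [intervalIntegral.integral_const_mul, integral_pow]
    simp [mul_div_assoc]
  simp only [← hint]
  refine intervalIntegral.hasSum_integral_of_dominated_convergence
    (fun n _ => |d n * x ^ n|) ?_ ?_ ?_ ?_ ?_
  · intro n
    exact (by fun_prop : Continuous fun t : ℝ => d n * t ^ n).aestronglyMeasurable
  · intro n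
    refine Eventually.of_forall fun t ht => ?_
    rw [Set.uIoc_of_le hx.1.le] at ht
    rw [Real.norm_eq_abs, abs_mul, abs_mul, abs_pow, abs_pow]
    rw [abs_of_pos ht.1, abs_of_pos hx.1]
    exact mul_le_mul_of_nonneg_left (pow_le_pow_left₀ ht.1.le ht.2 n) (abs_nonneg _)
  · exact Eventually.of_forall fun t _ => (h x hx).1
  · exact intervalIntegrable_const
  · refine Eventually.of_forall fun t ht => ?_
    rw [Set.uIoc_of_le hx.1.le] at ht
    exact (h t ⟨ht.1, ht.2.trans_lt hx.2⟩).2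

/-- The integrand is only required to be a power series on the open interval, since for `dt/t` its
value at `0` is the arbitrary value of a division by zero. -/
theorem hasValue_of_succ {f : PowerSeries ℝ} {d : ℕ → ℝ} {g : ℝ → ℝ}
    (hf0 : constantCoeff f = 0) (hf : ∀ n : ℕ, coeff (n + 1) f = d n / (n + 1))
    (h : ∀ x ∈ Set.Ioo (0 : ℝ) 1, (Summable fun n => |d n * x ^ n|) ∧
      HasSum (fun n => d n * x ^ n) (g x)) :
    HasValue f fun x => ∫ t in (0 : ℝ)..x, g t := by
  rw [← PowerSeries.coeff_zero_eq_constantCoeff_apply] at hf0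
  intro x hx
  rcases hx.1.eq_or_lt with rfl | hx0
  · have hz : (fun n => coeff n f * (0 : ℝ) ^ n) = 0 := by
      funext n
      rcases n with _ | n <;> simp [hf0]
    have hz' : (fun n => |coeff n f * (0 : ℝ) ^ n|) = 0 := by
      funext n
      simpa using congrFun hz n
    rw [hz, hz']
    simpa using ⟨summable_zero, hasSum_zero⟩
  · constructor
    · rw [← summable_nat_add_iff 1]
      refine Summable.of_nonneg_of_le (fun _ => abs_nonneg _) (fun n => ?_) (h x ⟨hx0, hx.2⟩).1
      rw [hf, abs_mul, abs_mul, pow_succ, abs_mul (x ^ n)]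
      have h1 : |d n / ((n : ℝ) + 1)| ≤ |d n| := by
        rw [abs_div]
        refine div_le_self (abs_nonneg _) ?_
        rw [abs_of_nonneg (by positivity)]
        linarith [(Nat.cast_nonneg n : (0 : ℝ) ≤ n)]
      have h2 : |x ^ n| * |x| ≤ |x ^ n| :=
        mul_le_of_le_one_right (abs_nonneg _) (by rw [abs_of_pos hx0]; exact hx.2.le)
      exact mul_le_mul h1 h2 (by positivity) (abs_nonneg _)
    · rw [← hasSum_nat_add_iff' 1]
      have h1 := hasSum_integral_of_hasSum h ⟨hx0, hx.2⟩
      simp only [Finset.range_one, Finset.sum_singleton, hf0, zero_mul, sub_zero, hf]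
      simpa only [div_mul_eq_mul_div] using h1

theorem HasValue.some_cons {w : List (Option ℤˣ)} {F : ℝ → ℝ} (h : HasValue (wordSeries w) F)
    (a : ℤˣ) : HasValue (wordSeries (some a :: w))
      fun x => ∫ t in (0 : ℝ)..x, letterForm (some a) t * F t := by
  have h' := (hasValue_gen a).mul h
  refine hasValue_of_succ (constantCoeff_wordSeries_cons _ _) (fun n => ?_)
    fun x hx => h' x ⟨hx.1.le, hx.2⟩
  simp [wordSeries, formalInt]

theorem HasValue.none_cons {w : List (Option ℤˣ)} {F : ℝ → ℝ} (h : HasValue (wordSeries w) F)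
    (hw : constantCoeff (wordSeries w) = 0) : HasValue (wordSeries (none :: w))
      fun x => ∫ t in (0 : ℝ)..x, letterForm none t * F t := by
  rw [← PowerSeries.coeff_zero_eq_constantCoeff_apply] at hw
  refine hasValue_of_succ (d := fun n => coeff (n + 1) (wordSeries w))
    (constantCoeff_wordSeries_cons _ _) (fun n => ?_) fun x hx => ?_
  · simp [wordSeries]
  · obtain ⟨h1, h2⟩ := h x ⟨hx.1.le, hx.2⟩
    have key : ∀ n, coeff (n + 1) (wordSeries w) * x ^ n =
        x⁻¹ * (coeff (n + 1) (wordSeries w) * x ^ (n + 1)) := by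
      intro n
      have := hx.1.ne'
      field_simp
      ring
    simp only [key]
    constructor
    · simp only [abs_mul x⁻¹]
      exact ((summable_nat_add_iff 1).mpr h1).mul_left _
    · rw [← hasSum_nat_add_iff' 1] at h2
      have h3 := h2.mul_left x⁻¹
      simpa [hw, letterForm] using h3

theorem hasValue_word (a : ℤˣ) (l : List Entry) :
    HasValue (wordSeries (word a l)) (iterInt ((word a l).map letterForm)) := by
  induction l generalizing a with
  | nil =>
    intro x _
    have key : (fun n => coeff n (wordSeries (word a [])) * x ^ n) =
        fun n => if n = 0 then (1 : ℝ) else 0 := by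
      funext n
      simp only [word, wordSeries, PowerSeries.coeff_one]
      split_ifs with h <;> simp [h]
    have h0 : HasSum (fun n : ℕ => if n = 0 then (1 : ℝ) else 0) 1 := hasSum_ite_eq 0 1
    refine ⟨?_, ?_⟩
    · exact (key ▸ h0.summable).abs
    · rw [key]
      simpa [word, iterInt] using h0
  | cons e l ih =>
    obtain ⟨s, z⟩ := e
    rw [word]
    induction s - 1 with
    | zero => simpa [iterInt] using! (ih (a * z)).some_cons (a * z)
    | succ k ihk =>
      rw [List.replicate_succ, List.cons_append, List.map_cons]
      refine HasValue.none_cons ihk ?_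
      cases k
      · exact constantCoeff_wordSeries_cons _ _
      · exact constantCoeff_wordSeries_cons _ _

/-- The truncated iterated integral as a power series in `1 - ε`. -/
theorem hasSum_truncInt {l : List Entry} (hl : IsIndex l) {ε : ℝ} (hε : ε ∈ Set.Ioc (0 : ℝ) 1) :
    HasSum (fun n => coef l n * (1 - ε) ^ n) (truncInt l ε) := by
  have h := (hasValue_word 1 l (1 - ε) ⟨by linarith [hε.2], by linarith [hε.1]⟩).2
  rw [← forms_eq_map_word] at h
  simpa [coeff_wordSeries_word 1 l hl] using! h

/-! ### Asymptotic expansions of truncated sums -/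

/-- The sequence is `O(n ^ (-1/2))`. -/
def IsSmall (e : ℕ → ℝ) : Prop := ∃ C, ∀ n : ℕ, |e n| ≤ C / √(n + 1)

theorem IsSmall.add {e f : ℕ → ℝ} (he : IsSmall e) (hf : IsSmall f) :
    IsSmall fun n => e n + f n := by
  obtain ⟨C, hC⟩ := he
  obtain ⟨D, hD⟩ := hf
  refine ⟨C + D, fun n => ?_⟩
  rw [add_div]
  exact (abs_add_le _ _).trans (add_le_add (hC n) (hD n))

theorem IsSmall.tendsto {e : ℕ → ℝ} (he : IsSmall e) : Tendsto e atTop (𝓝 0) := by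
  obtain ⟨C, hC⟩ := he
  refine squeeze_zero_norm hC ?_
  refine Tendsto.const_div_atTop ?_ C
  exact Real.tendsto_sqrt_atTop.comp
    (tendsto_atTop_add_const_right _ _ tendsto_natCast_atTop_atTop)

theorem inv_sqrt_le_sub_sqrt (n : ℕ) : 1 / √((n : ℝ) + 1) ≤ 2 * (√((n : ℝ) + 1) - √n) := by
  have h1 : √((n : ℝ) + 1) ^ 2 = n + 1 := Real.sq_sqrt (by positivity)
  have h2 : √(n : ℝ) ^ 2 = n := Real.sq_sqrt (by positivity)
  have h3 : 0 < √((n : ℝ) + 1) := Real.sqrt_pos.mpr (by positivity)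
  have h4 : 0 ≤ √(n : ℝ) := Real.sqrt_nonneg _
  rw [div_le_iff₀ h3]
  nlinarith [sq_nonneg (√((n : ℝ) + 1) - √n)]

theorem inv_mul_sqrt_le_sub (n : ℕ) : 1 / (((n : ℝ) + 1) * √((n : ℝ) + 1)) ≤
    6 * (1 / √((n : ℝ) + 1) - 1 / √((n : ℝ) + 1 + 1)) := by
  have hn : (0 : ℝ) ≤ n := Nat.cast_nonneg n
  have h1 : √((n : ℝ) + 1) ^ 2 = n + 1 := Real.sq_sqrt (by positivity)
  have h2 : √((n : ℝ) + 1 + 1) ^ 2 = n + 1 + 1 := Real.sq_sqrt (by positivity)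
  have hr : 0 < √((n : ℝ) + 1) := Real.sqrt_pos.mpr (by positivity)
  have ht : 0 < √((n : ℝ) + 1 + 1) := Real.sqrt_pos.mpr (by positivity)
  set r := √((n : ℝ) + 1)
  set t := √((n : ℝ) + 1 + 1)
  have hr1 : 1 ≤ r ^ 2 := by linarith
  rw [← h1]
  -- The constant `6` comes from `r * t * (t + r) ≤ r * (2 * r) * (3 * r)`.
  have htr : t ≤ 2 * r := by
    refine abs_le_of_sq_le_sq' ?_ (by positivity) |>.2
    nlinarith
  have hsq : (t - r) * (t + r) = 1 := by nlinarith
  have key : 1 / r - 1 / t = 1 / (r * t * (t + r)) := by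
    field_simp
    linarith
  rw [key, mul_one_div, div_le_div_iff₀ (by positivity) (by positivity)]
  have : r * t * (t + r) ≤ r * (2 * r) * (2 * r + r) := by gcongr
  nlinarith

/-- A sequence with increments `O(n ^ (-3/2))` converges, with error `O(n ^ (-1/2))`. -/
theorem exists_isSmall_sub_const {a : ℕ → ℝ} {C : ℝ}
    (h : ∀ n : ℕ, |a (n + 1) - a n| ≤ C * (1 / (((n : ℝ) + 1) * √((n : ℝ) + 1)))) :
    ∃ L, IsSmall fun n => a n - L := by
  have hC : 0 ≤ C := by
    have h0 := (abs_nonneg _).trans (h 0)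
    simpa using h0
  have hstep : ∀ n : ℕ, |a (n + 1) - a n| ≤
      6 * C * (1 / √((n : ℝ) + 1)) - 6 * C * (1 / √(((n + 1 : ℕ) : ℝ) + 1)) := by
    intro n
    push_cast
    have := mul_le_mul_of_nonneg_left (inv_mul_sqrt_le_sub n) hC
    linarith [h n]
  have hle : ∀ n m : ℕ, |a (n + m) - a n| ≤
      6 * C * (1 / √((n : ℝ) + 1)) - 6 * C * (1 / √(((n + m : ℕ) : ℝ) + 1)) := by
    intro n m
    induction m with
    | zero => simp
    | succ m ih =>
      have h1 := hstep (n + m)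
      have h2 := abs_sub_le (a (n + (m + 1))) (a (n + m)) (a n)
      rw [← add_assoc] at h2 ⊢
      linarith
  have hbd : ∀ n m : ℕ, n ≤ m → |a m - a n| ≤ 6 * C / √((n : ℝ) + 1) := by
    intro n m hnm
    obtain ⟨j, rfl⟩ := Nat.exists_eq_add_of_le hnm
    refine (hle n j).trans ?_
    rw [mul_one_div]
    have : 0 ≤ 6 * C * (1 / √(((n + j : ℕ) : ℝ) + 1)) := by positivity
    linarith
  have hlim : Tendsto (fun n : ℕ => 6 * C / √((n : ℝ) + 1)) atTop (𝓝 0) := by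
    refine Tendsto.const_div_atTop ?_ _
    exact Real.tendsto_sqrt_atTop.comp
      (tendsto_atTop_add_const_right _ _ tendsto_natCast_atTop_atTop)
  have hcau : CauchySeq a := by
    refine cauchySeq_of_le_tendsto_0' _ (fun n m hnm => ?_) hlim
    rw [dist_comm]
    exact hbd n m hnm
  obtain ⟨L, hL⟩ := cauchySeq_tendsto_of_complete hcau
  refine ⟨L, 6 * C, fun n => ?_⟩
  rw [abs_sub_comm]
  refine le_of_tendsto ((hL.sub_const (a n)).abs) ?_
  filter_upwards [eventually_ge_atTop n] with m hm
  exact hbd n m hm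

/-- A sequence with increments `O(n ^ (-1/2))` is `O(n ^ (1/2))`. -/
theorem exists_abs_le_mul_sqrt {a : ℕ → ℝ} {C : ℝ}
    (h : ∀ n : ℕ, |a (n + 1) - a n| ≤ C * (1 / √((n : ℝ) + 1))) :
    ∃ D, 0 ≤ D ∧ ∀ n : ℕ, |a n| ≤ D * √((n : ℝ) + 1) := by
  have hC : 0 ≤ C := by
    have h0 := (abs_nonneg _).trans (h 0)
    simpa using h0
  have hle : ∀ n : ℕ, |a n| ≤ |a 0| + 2 * C * √n := by
    intro n
    induction n with
    | zero => simp
    | succ n ih =>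
      have h1 := mul_le_mul_of_nonneg_left (inv_sqrt_le_sub_sqrt n) hC
      have h2 := abs_sub_abs_le_abs_sub (a (n + 1)) (a n)
      push_cast
      linarith [h n]
  refine ⟨|a 0| + 2 * C, by positivity, fun n => (hle n).trans ?_⟩
  have h1 : 1 ≤ √((n : ℝ) + 1) := by
    rw [Real.one_le_sqrt]
    linarith [(Nat.cast_nonneg n : (0 : ℝ) ≤ n)]
  have h2 : √(n : ℝ) ≤ √((n : ℝ) + 1) := Real.sqrt_le_sqrt (by linarith)
  nlinarith [abs_nonneg (a 0)]

theorem sqrt_div_self_add_one (n : ℕ) : √((n : ℝ) + 1) / ((n : ℝ) + 1) = 1 / √((n : ℝ) + 1) :=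
  Real.sqrt_div_self'

theorem abs_unit_pow (z : ℤˣ) (n : ℕ) : |((z : ℤ) : ℝ) ^ n| = 1 := by
  rcases Int.units_eq_one_or z with rfl | rfl <;> simp

/-- Used with `t = 0` for growth bounds on any index, and with `t = 1` for convergence when the
first exponent is at least `2`. -/
theorem abs_coef_cons_le {s : ℕ} (z : ℤˣ) (l : List Entry) {D : ℝ}
    (hD : ∀ n : ℕ, |truncSum l n| ≤ D * √((n : ℝ) + 1)) {t : ℕ} (hs : t + 1 ≤ s) (n : ℕ) :
    |truncSum ((s, z) :: l) (n + 1) - truncSum ((s, z) :: l) n| ≤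
      D * (1 / (((n : ℝ) + 1) ^ t * √((n : ℝ) + 1))) := by
  have hn : (1 : ℝ) ≤ (n : ℝ) + 1 := by linarith [(Nat.cast_nonneg n : (0 : ℝ) ≤ n)]
  rw [truncSum_succ, add_sub_cancel_left, coef_cons_succ, abs_mul, abs_div, abs_unit_pow,
    abs_of_nonneg (a := ((n : ℝ) + 1) ^ s) (by positivity)]
  calc 1 / ((n : ℝ) + 1) ^ s * |truncSum l n|
      ≤ 1 / ((n : ℝ) + 1) ^ (t + 1) * (D * √((n : ℝ) + 1)) := by
        gcongr
        exact hD n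
    _ = D * (1 / ((n : ℝ) + 1) ^ t * (√((n : ℝ) + 1) / ((n : ℝ) + 1))) := by
        rw [pow_succ]
        field_simp
    _ = _ := by
        rw [sqrt_div_self_add_one, one_div_mul_one_div]

/-- The true growth is a power of `log n`; the cruder square root is stable under the induction and
still small enough for every later estimate. -/
theorem exists_abs_truncSum_le (l : List Entry) (hl : IsIndex l) :
    ∃ D, 0 ≤ D ∧ ∀ n : ℕ, |truncSum l n| ≤ D * √((n : ℝ) + 1) := by
  induction l with
  | nil => exact exists_abs_le_mul_sqrt (C := 0) (by simp [truncSum])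
  | cons e l ih =>
    obtain ⟨D, -, hD⟩ := ih fun e he => hl e (by simp [he])
    refine exists_abs_le_mul_sqrt (C := D) fun n => ?_
    have := abs_coef_cons_le (s := e.1) e.2 l hD (t := 0) (hl e (by simp)) n
    simpa using this

theorem exists_abs_truncSum_sub_le (l : List Entry) (hl : IsIndex l) :
    ∃ D, 0 ≤ D ∧ ∀ n : ℕ, |truncSum l (n + 1) - truncSum l n| ≤ D * (1 / √((n : ℝ) + 1)) := by
  rcases l with _ | ⟨e, l⟩
  · exact ⟨0, le_rfl, by simp [truncSum]⟩
  · obtain ⟨D, hD0, hD⟩ := exists_abs_truncSum_le l fun e he => hl e (by simp [he])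
    refine ⟨D, hD0, fun n => ?_⟩
    have := abs_coef_cons_le (s := e.1) e.2 l hD (t := 0) (hl e (by simp)) n
    simpa using this

theorem exists_isSmall_truncSum_of_two_le (s : ℕ) (z : ℤˣ) (l : List Entry) (hl : IsIndex l)
    (hs : 2 ≤ s) : ∃ L, IsSmall fun n => truncSum ((s, z) :: l) n - L := by
  obtain ⟨D, -, hD⟩ := exists_abs_truncSum_le l hl
  refine exists_isSmall_sub_const (C := D) fun n => ?_
  simpa using abs_coef_cons_le (s := s) z l hD (t := 1) hs n

/-- The increments alternate in sign with slowly varying size `g n`. Subtracting half of the current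
term, `(-1) ^ n * g n / 2`, replaces them by half-differences of `g`, which are `O(n ^ (-3/2))`. -/
theorem exists_isSmall_truncSum_of_neg_one (l : List Entry) (hl : IsIndex l) :
    ∃ L, IsSmall fun n => truncSum ((1, -1) :: l) n - L := by
  obtain ⟨D, hD0, hD⟩ := exists_abs_truncSum_le l hl
  obtain ⟨D', hD0', hD'⟩ := exists_abs_truncSum_sub_le l hl
  set g : ℕ → ℝ := fun n => truncSum l n / (n + 1) with hg
  have hgb : ∀ n : ℕ, |g n| ≤ D * (1 / √((n : ℝ) + 1)) := by
    intro n
    rw [hg]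
    simp only
    rw [abs_div, abs_of_nonneg (a := (n : ℝ) + 1) (by positivity), ← sqrt_div_self_add_one,
      ← mul_div_assoc]
    gcongr
    exact hD n
  have hgd : ∀ n : ℕ, |g n - g (n + 1)| ≤
      (D + D') * (1 / (((n : ℝ) + 1) * √((n : ℝ) + 1))) := by
    intro n
    have h1 : g n - g (n + 1) = (g n - (truncSum l (n + 1) - truncSum l n)) / (n + 1 + 1) := by
      simp only [hg]
      push_cast
      field_simp
      ring
    rw [h1, abs_div, abs_of_nonneg (a := (n : ℝ) + 1 + 1) (by positivity)]
    calc |g n - (truncSum l (n + 1) - truncSum l n)| / ((n : ℝ) + 1 + 1)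
        ≤ (D * (1 / √((n : ℝ) + 1)) + D' * (1 / √((n : ℝ) + 1))) / ((n : ℝ) + 1) := by
          gcongr
          · exact (abs_sub _ _).trans (add_le_add (hgb n) (hD' n))
          · linarith
      _ = _ := by
          field_simp
  obtain ⟨L, hL⟩ := exists_isSmall_sub_const
    (a := fun n => truncSum ((1, -1) :: l) n - (-1) ^ n * g n / 2) (C := (D + D')) fun n => by
      have h1 : truncSum ((1, -1) :: l) (n + 1) - (-1) ^ (n + 1) * g (n + 1) / 2
          - (truncSum ((1, -1) :: l) n - (-1) ^ n * g n / 2) =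
          (-1) ^ (n + 1) * ((g n - g (n + 1)) / 2) := by
        rw [truncSum_succ, coef_cons_succ]
        simp only [hg]
        push_cast
        field_simp
        ring
      rw [h1, abs_mul, abs_pow, abs_neg, abs_one, one_pow, one_mul, abs_div, abs_two]
      have := hgd n
      have := abs_nonneg (g n - g (n + 1))
      linarith
  refine ⟨L, ?_⟩
  have h2 : IsSmall fun n => (-1) ^ n * g n / 2 := by
    refine ⟨D, fun n => ?_⟩
    rw [abs_div, abs_mul, abs_pow, abs_neg, abs_one, one_pow, one_mul, abs_two]
    have := hgb n
    rw [mul_one_div] at this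
    have := abs_nonneg (g n)
    linarith
  convert hL.add h2 using 2
  ring

theorem isSmall_truncSum_sub_eulerSum {l : List Entry} (hl : IsAdmissible l) :
    IsSmall fun n => truncSum l n - eulerSum l := by
  obtain ⟨L, hL⟩ : ∃ L, IsSmall fun n => truncSum l n - L := by
    obtain ⟨hidx, hne, hhead⟩ := hl
    rcases l with _ | ⟨⟨s, z⟩, l⟩
    · exact absurd rfl hne
    · have hs : 1 ≤ s := hidx (s, z) (by simp)
      have hl' : IsIndex l := fun e he => hidx e (by simp [he])
      rcases hs.eq_or_lt with rfl | hs
      · rcases Int.units_eq_one_or z with rfl | rfl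
        · exact absurd rfl hhead
        · exact exists_isSmall_truncSum_of_neg_one l hl'
      · exact exists_isSmall_truncSum_of_two_le s z l hl' hs
  have h : Tendsto (truncSum l) atTop (𝓝 L) := by
    have := hL.tendsto.add_const L
    simpa using this
  rwa [eulerSum, h.limUnder_eq]

theorem tendsto_truncSum {l : List Entry} (hl : IsAdmissible l) :
    Tendsto (truncSum l) atTop (𝓝 (eulerSum l)) := by
  simpa using (isSmall_truncSum_sub_eulerSum hl).tendsto.add_const (eulerSum l)

/-- The sequence of truncations of `ζ(1, …, 1)` of depth `k`. -/
noncomputable def ones (k : ℕ) : ℕ → ℝ := truncSum (List.replicate k (pos 1))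

theorem ones_zero (n : ℕ) : ones 0 n = 1 := rfl

theorem ones_succ_succ (k n : ℕ) : ones (k + 1) (n + 1) = ones (k + 1) n + ones k n / (n + 1) := by
  rw [ones, ones, List.replicate_succ, truncSum_succ]
  simp only [pos, coef_cons_succ]
  simp
  ring

/-- `a` is the linear combination of `ones 0, …, ones d` with coefficients `c`, up to a
small error. -/
def HasExpansion (a : ℕ → ℝ) (d : ℕ) (c : ℕ → ℝ) : Prop :=
  IsSmall fun n => a n - ∑ k ∈ Finset.range (d + 1), c k * ones k n

theorem hasExpansion_of_admissible {l : List Entry} (hl : IsAdmissible l) :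
    HasExpansion (truncSum l) 0 fun _ => eulerSum l := by
  simpa [HasExpansion, ones_zero] using isSmall_truncSum_sub_eulerSum hl

/-- Prefixing a `1` to both sides shifts `ones k` to `ones (k + 1)` and divides the error by `n + 1`
before summing it, so the summed error converges. Its limit is the new coefficient of `ones 0`. -/
theorem HasExpansion.pos_one_cons {l : List Entry} {d : ℕ} {c : ℕ → ℝ}
    (h : HasExpansion (truncSum l) d c) :
    ∃ c' : ℕ → ℝ, (∀ k, c' (k + 1) = c k) ∧
      HasExpansion (truncSum (pos 1 :: l)) (d + 1) c' := by
  obtain ⟨C, hC⟩ := h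
  obtain ⟨L, hL⟩ := exists_isSmall_sub_const
    (a := fun n => truncSum (pos 1 :: l) n - ∑ k ∈ Finset.range (d + 1), c k * ones (k + 1) n)
    (C := C) fun n => by
      have h1 : truncSum (pos 1 :: l) (n + 1)
            - ∑ k ∈ Finset.range (d + 1), c k * ones (k + 1) (n + 1)
          - (truncSum (pos 1 :: l) n - ∑ k ∈ Finset.range (d + 1), c k * ones (k + 1) n) =
          (truncSum l n - ∑ k ∈ Finset.range (d + 1), c k * ones k n) / (n + 1) := by
        have h2 : ∀ k, c k * ones (k + 1) (n + 1) =
            c k * ones (k + 1) n + c k * ones k n / (n + 1) := fun k => by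
          rw [ones_succ_succ]; ring
        simp only [h2, Finset.sum_add_distrib, ← Finset.sum_div, truncSum_succ, pos,
          coef_cons_succ]
        simp
        ring
      rw [h1, abs_div, abs_of_nonneg (a := (n : ℝ) + 1) (by positivity)]
      calc _ ≤ C / √((n : ℝ) + 1) / ((n : ℝ) + 1) := by gcongr; exact hC n
        _ = _ := by field_simp
  refine ⟨fun k => Nat.casesOn k L c, fun k => rfl, ?_⟩
  rw [HasExpansion]
  convert hL using 2 with n
  rw [Finset.sum_range_succ', ones_zero, mul_one]
  exact sub_add_eq_sub_sub _ _ _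

theorem HasExpansion.mono {a : ℕ → ℝ} {d d' : ℕ} {c : ℕ → ℝ} (h : HasExpansion a d c)
    (hd : d ≤ d') : HasExpansion a d' fun k => if k ≤ d then c k else 0 := by
  rw [HasExpansion] at h ⊢
  convert h using 3 with n
  obtain ⟨j, rfl⟩ := Nat.exists_eq_add_of_le hd
  rw [show d + j + 1 = (d + 1) + j by ring, Finset.sum_range_add]
  have h1 : ∑ k ∈ Finset.range j,
      (if d + 1 + k ≤ d then c (d + 1 + k) else 0) * ones (d + 1 + k) n = 0 :=
    Finset.sum_eq_zero fun k _ => by rw [if_neg (by omega), zero_mul]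
  rw [h1, add_zero]
  refine Finset.sum_congr rfl fun k hk => ?_
  rw [if_pos (by simpa [Nat.lt_succ_iff] using hk)]

theorem exists_hasExpansion (l : List Entry) (hl : IsIndex l) :
    ∃ c, HasExpansion (truncSum l) l.length c := by
  induction l with
  | nil => exact ⟨fun _ => 1, 0, fun n => by simp [truncSum, ones_zero]⟩
  | cons e l ih =>
    by_cases h1 : e = pos 1
    · subst h1
      obtain ⟨c, hc⟩ := ih fun e he => hl e (by simp [he])
      obtain ⟨c', -, hc'⟩ := hc.pos_one_cons
      exact ⟨c', hc'⟩
    · have hadm : IsAdmissible (e :: l) := ⟨hl, by simp, by simpa using h1⟩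
      exact ⟨_, (hasExpansion_of_admissible hadm).mono (Nat.zero_le _)⟩

/-! ### Regularization along a filter -/

/-- The function `a` agrees with `P(T)` up to an error smaller than every power of `T⁻¹`. -/
def Reg {α : Type*} (F : Filter α) (T a : α → ℝ) (P : ℝ[X]) : Prop :=
  ∀ k : ℕ, Tendsto (fun i => T i ^ k * (a i - P.eval (T i))) F (𝓝 0)

section Reg

variable {α : Type*} {F : Filter α} {T a b : α → ℝ} {P Q : ℝ[X]}

theorem Reg.tendsto (h : Reg F T a P) : Tendsto (fun i => a i - P.eval (T i)) F (𝓝 0) := by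
  simpa using h 0

theorem Reg.congr (h : Reg F T a P) (hab : ∀ᶠ i in F, a i = b i) : Reg F T b P := fun k =>
  (h k).congr' (hab.mono fun i hi => by rw [hi])

theorem Reg.add (h : Reg F T a P) (h' : Reg F T b Q) : Reg F T (fun i => a i + b i) (P + Q) := by
  intro k
  have := (h k).add (h' k)
  rw [add_zero] at this
  refine this.congr fun i => ?_
  rw [eval_add]
  ring

theorem Reg.tendsto_eval_mul (h : Reg F T a P) (Q : ℝ[X]) (k : ℕ) :
    Tendsto (fun i => Q.eval (T i) * (T i ^ k * (a i - P.eval (T i)))) F (𝓝 0) := by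
  induction Q using Polynomial.induction_on' with
  | add p q hp hq =>
    simpa [add_mul] using hp.add hq
  | monomial n c =>
    have := (h (n + k)).const_mul c
    rw [mul_zero] at this
    refine this.congr fun i => ?_
    rw [eval_monomial, pow_add]
    ring

/-- Here `a * b - P * Q = (a - P) * (b - Q) + (a - P) * Q + (b - Q) * P`. An error that is merely
`o(1)` need not survive multiplication by a polynomial in `T`, hence the strong decay built into
`Reg`. -/
theorem Reg.mul (h : Reg F T a P) (h' : Reg F T b Q) : Reg F T (fun i => a i * b i) (P * Q) := by
  intro k
  have := (((h k).mul h'.tendsto).add (h.tendsto_eval_mul Q k)).add (h'.tendsto_eval_mul P k)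
  simp only [mul_zero, add_zero] at this
  refine this.congr fun i => ?_
  rw [eval_mul]
  ring

theorem Reg.const (c : ℝ) : Reg F T (fun _ => c) (C c) := by
  intro k
  simpa using tendsto_const_nhds

theorem Reg.id : Reg F T T X := by
  intro k
  simpa using tendsto_const_nhds

theorem Reg.const_mul (c : ℝ) (h : Reg F T a P) : Reg F T (fun i => c * a i) (C c * P) :=
  (Reg.const c).mul h

theorem Reg.sub (h : Reg F T a P) (h' : Reg F T b Q) : Reg F T (fun i => a i - b i) (P - Q) := by
  have := h.add (h'.const_mul (-1))
  rw [C_neg, C_1, neg_one_mul, ← sub_eq_add_neg] at this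
  exact this.congr (Eventually.of_forall fun i => by ring)

theorem Reg.sum {ι : Type*} (s : Finset ι) {a : ι → α → ℝ} {P : ι → ℝ[X]}
    (h : ∀ j ∈ s, Reg F T (a j) (P j)) : Reg F T (fun i => ∑ j ∈ s, a j i) (∑ j ∈ s, P j) := by
  classical
  induction s using Finset.induction_on with
  | empty => simpa using! Reg.const (F := F) (T := T) 0
  | insert j s hj ih =>
    simp only [Finset.sum_insert hj]
    exact (h j (Finset.mem_insert_self _ _)).add
      (ih fun i hi => h i (Finset.mem_insert_of_mem hi))

theorem Reg.unique [F.NeBot] (hT : Tendsto T F atTop) (h : Reg F T a P) (h' : Reg F T a Q) :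
    P = Q := by
  refine sub_eq_zero.mp (eq_zero_of_tendsto hT ?_)
  simpa using h'.tendsto.sub h.tendsto

/-- An exponentially small error has regularization zero. -/
theorem reg_zero_of_abs_le (hT : Tendsto T F atTop) {δ C : ℝ} (hδ : 0 < δ)
    (h : ∀ᶠ i in F, |a i| ≤ C * Real.exp (-(δ * T i))) : Reg F T a 0 := by
  intro k
  have h1 : Tendsto (fun i => δ * T i) F atTop := hT.const_mul_atTop hδ
  have h2 := ((Real.tendsto_pow_mul_exp_neg_atTop_nhds_zero k).comp h1).const_mul (C / δ ^ k)
  rw [mul_zero] at h2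
  refine squeeze_zero_norm' ?_ h2
  filter_upwards [h, hT.eventually_ge_atTop 0] with i hi hi0
  rw [eval_zero, sub_zero, Real.norm_eq_abs, abs_mul, abs_of_nonneg (pow_nonneg hi0 k)]
  calc T i ^ k * |a i| ≤ T i ^ k * (C * Real.exp (-(δ * T i))) := by gcongr
    _ = _ := by
      simp only [Function.comp, mul_pow]
      field_simp

end Reg

/-! ### Stuffle regularization -/

/-- The variable of the stuffle regularization. -/
noncomputable def stuffleVar (M : ℕ) : ℝ := Real.log M + Real.eulerMascheroniConstant

theorem tendsto_stuffleVar : Tendsto stuffleVar atTop atTop :=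
  tendsto_atTop_add_const_right _ _ (Real.tendsto_log_atTop.comp tendsto_natCast_atTop_atTop)

theorem exp_neg_mul_stuffleVar (δ : ℝ) {n : ℕ} (hn : 1 ≤ n) :
    Real.exp (-(δ * stuffleVar n)) =
      Real.exp (-(δ * Real.eulerMascheroniConstant)) * (n : ℝ) ^ (-δ) := by
  have : (0 : ℝ) < n := by exact_mod_cast hn
  rw [Real.rpow_def_of_pos this, ← Real.exp_add, stuffleVar]
  congr 1
  ring

theorem IsSmall.reg {e : ℕ → ℝ} (he : IsSmall e) : Reg atTop stuffleVar e 0 := by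
  obtain ⟨C, hC⟩ := he
  have hC0 : 0 ≤ C := by simpa using (abs_nonneg _).trans (hC 0)
  -- In this variable `n ^ (-1/2)` is `exp (γ / 2) * exp (-T / 2)`.
  refine reg_zero_of_abs_le tendsto_stuffleVar (δ := 1 / 2)
    (C := C * Real.exp (1 / 2 * Real.eulerMascheroniConstant)) (by norm_num) ?_
  filter_upwards [eventually_ge_atTop 1] with n hn
  have hn0 : (0 : ℝ) < n := by exact_mod_cast hn
  rw [exp_neg_mul_stuffleVar _ hn, ← mul_assoc, mul_assoc C, ← Real.exp_add, add_neg_cancel,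
    Real.exp_zero, mul_one, Real.rpow_neg hn0.le, ← Real.sqrt_eq_rpow, ← div_eq_mul_inv]
  refine (hC n).trans ?_
  gcongr
  linarith

theorem ones_one_eq_harmonic (n : ℕ) : ones 1 n = harmonic n := by
  induction n with
  | zero => simp [ones, truncSum, pos]
  | succ n ih =>
    rw [ones_succ_succ, ih, ones_zero, harmonic_succ]
    push_cast
    ring

theorem reg_ones_one : Reg atTop stuffleVar (ones 1) X := by
  have h : Reg atTop stuffleVar (fun n => ones 1 n - stuffleVar n) 0 := by
    refine reg_zero_of_abs_le tendsto_stuffleVar (δ := 1)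
      (C := Real.exp (1 * Real.eulerMascheroniConstant)) one_pos ?_
    filter_upwards [eventually_ge_atTop 1] with n hn
    have hn0 : (0 : ℝ) < n := by exact_mod_cast hn
    rw [exp_neg_mul_stuffleVar _ hn, ← mul_assoc, ← Real.exp_add, add_neg_cancel, Real.exp_zero,
      one_mul, Real.rpow_neg_one, ones_one_eq_harmonic, stuffleVar]
    have h1 := Real.eulerMascheroniSeq_lt_eulerMascheroniConstant n
    have h2 := Real.eulerMascheroniConstant_lt_eulerMascheroniSeq' n
    rw [Real.eulerMascheroniSeq] at h1
    rw [Real.eulerMascheroniSeq', if_neg (by omega)] at h2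
    have h3 : Real.log ((n : ℝ) + 1) - Real.log n ≤ (n : ℝ)⁻¹ := by
      rw [← Real.log_div (by positivity) (by positivity)]
      refine (Real.log_le_sub_one_of_pos (by positivity)).trans_eq ?_
      field_simp
      ring
    rw [abs_le]
    have : 0 < (n : ℝ)⁻¹ := by positivity
    constructor <;> linarith
  have := h.add Reg.id
  rw [zero_add] at this
  exact this.congr (Eventually.of_forall fun n => by ring)

theorem reg_truncSum_of_admissible {l : List Entry} (hl : IsAdmissible l) :
    Reg atTop stuffleVar (truncSum l) (C (eulerSum l)) := by
  have := (isSmall_truncSum_sub_eulerSum hl).reg.add (Reg.const (eulerSum l))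
  rw [zero_add] at this
  exact this.congr (Eventually.of_forall fun n => by ring)

theorem truncSum_singleton_succ (s n : ℕ) :
    truncSum [pos s] (n + 1) = truncSum [pos s] n + (1 / ((n : ℝ) + 1)) ^ s := by
  rw [truncSum_succ, pos, coef_cons_succ]
  simp [truncSum]

theorem ones_one_sq (n : ℕ) : ones 1 n ^ 2 = 2 * ones 2 n + truncSum [pos 2] n := by
  induction n with
  | zero => simp [ones, truncSum, pos]
  | succ n ih =>
    rw [ones_succ_succ, ones_succ_succ, truncSum_singleton_succ, ones_zero]
    linear_combination ih

/-- Newton's identity between elementary symmetric functions and power sums of `1, 1/2, …, 1/n`,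
reducing `ones 3` to harmonic numbers and convergent sums. -/
theorem ones_one_mul_ones_two (n : ℕ) : ones 1 n * ones 2 n =
    3 * ones 3 n + ones 1 n * truncSum [pos 2] n - truncSum [pos 3] n := by
  induction n with
  | zero => simp [ones, truncSum, pos]
  | succ n ih =>
    rw [ones_succ_succ, ones_succ_succ, ones_succ_succ, truncSum_singleton_succ,
      truncSum_singleton_succ, ones_zero]
    linear_combination ih + (1 / ((n : ℝ) + 1)) * ones_one_sq n

theorem isAdmissible_pos {s : ℕ} (hs : 2 ≤ s) : IsAdmissible [pos s] := by
  refine ⟨fun e he => ?_, by simp, ?_⟩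
  · rw [List.mem_singleton.mp he]
    exact (by omega : 1 ≤ s)
  · simp [pos]
    omega

/-- The stuffle regularization of `ζ(1, …, 1)` in depth `k ≤ 3`. -/
noncomputable def onesPoly : ℕ → ℝ[X]
  | 0 => 1
  | 1 => X
  | 2 => C (1 / 2) * (X * X - C (eulerSum [pos 2]))
  | _ => C (1 / 3) * (X * (C (1 / 2) * (X * X - C (eulerSum [pos 2])))
      - X * C (eulerSum [pos 2]) + C (eulerSum [pos 3]))

theorem reg_ones {k : ℕ} (hk : k ≤ 3) : Reg atTop stuffleVar (ones k) (onesPoly k) := by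
  have h2 := reg_truncSum_of_admissible (isAdmissible_pos (s := 2) le_rfl)
  have h3 := reg_truncSum_of_admissible (isAdmissible_pos (s := 3) (by norm_num))
  have hones2 : Reg atTop stuffleVar (ones 2) (onesPoly 2) := by
    refine (((reg_ones_one.mul reg_ones_one).sub h2).const_mul (1 / 2)).congr
      (Eventually.of_forall fun n => ?_)
    linear_combination (1 / 2) * ones_one_sq n
  interval_cases k
  · simpa using! Reg.const (F := atTop) (T := stuffleVar) 1
  · exact reg_ones_one
  · exact hones2
  · refine ((((reg_ones_one.mul hones2).sub (reg_ones_one.mul h2)).add h3).const_mul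
      (1 / 3)).congr (Eventually.of_forall fun n => ?_)
    linear_combination (1 / 3) * ones_one_mul_ones_two n

theorem HasExpansion.reg {a : ℕ → ℝ} {d : ℕ} {c : ℕ → ℝ} (h : HasExpansion a d c) (hd : d ≤ 3) :
    Reg atTop stuffleVar a (∑ k ∈ Finset.range (d + 1), C (c k) * onesPoly k) := by
  have h1 : Reg atTop stuffleVar (fun n => ∑ k ∈ Finset.range (d + 1), c k * ones k n)
      (∑ k ∈ Finset.range (d + 1), C (c k) * onesPoly k) :=
    Reg.sum _ fun k hk => (reg_ones (by have := Finset.mem_range.mp hk; omega)).const_mul (c k)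
  have := (IsSmall.reg h).add h1
  rw [zero_add] at this
  exact this.congr (Eventually.of_forall fun n => by ring)

/-! ### Shuffle regularization -/

/-- The variable of the shuffle regularization. -/
noncomputable def shuffleVar (ε : ℝ) : ℝ := -Real.log ε

theorem tendsto_shuffleVar : Tendsto shuffleVar (𝓝[>] 0) atTop :=
  tendsto_neg_atBot_atTop.comp Real.tendsto_log_nhdsGT_zero

theorem wordSeries_replicate_one (k : ℕ) :
    (k.factorial : PowerSeries ℝ) * wordSeries (List.replicate k (some 1)) =
      wordSeries [some 1] ^ k := by
  have hone : wordSeries [] = 1 := rfl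
  induction k with
  | zero => simp [hone]
  | succ k ih =>
    refine PowerSeries.derivative.ext ?_ ?_
    · rw [PowerSeries.derivative_pow, Derivation.leibniz, List.replicate_succ,
        derivative_wordSeries_some, derivative_wordSeries_some, hone, Nat.add_sub_cancel, ← ih,
        Derivation.map_natCast, Nat.factorial_succ]
      simp only [smul_eq_mul]
      push_cast
      ring
    · simp [constantCoeff_wordSeries_cons, List.replicate_succ]

theorem word_ones (k : ℕ) : word 1 (List.replicate k (pos 1)) = List.replicate k (some 1) := by
  induction k with
  | zero => rfl
  | succ k ih => simpa [List.replicate_succ, word, pos] using ih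

theorem HasValue.pow {f : PowerSeries ℝ} {F : ℝ → ℝ} (h : HasValue f F) (k : ℕ) :
    HasValue (f ^ k) fun x => F x ^ k := by
  induction k with
  | zero => simpa [word, wordSeries, iterInt] using! hasValue_word 1 []
  | succ k ih => simpa [pow_succ] using ih.mul h

theorem isIndex_ones (k : ℕ) : IsIndex (List.replicate k (pos 1)) := fun e he => by
  rw [List.eq_of_mem_replicate he, pos]

theorem truncInt_pos_one {ε : ℝ} (hε : ε ∈ Set.Ioc (0 : ℝ) 1) :
    truncInt [pos 1] ε = shuffleVar ε := by
  have h := hasSum_truncInt (l := [pos 1]) (isIndex_ones 1) hε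
  rw [← hasSum_nat_add_iff' 1] at h
  have h1 := Real.hasSum_pow_div_log_of_abs_lt_one (x := 1 - ε)
    (by rw [abs_lt]; constructor <;> linarith [hε.1, hε.2])
  simp only [Finset.range_one, Finset.sum_singleton, coef_cons_zero, zero_mul, sub_zero] at h
  rw [sub_sub_cancel] at h1
  refine h.unique (h1.congr_fun fun n => ?_)
  rw [pos, coef_cons_succ]
  simp [truncSum, div_eq_inv_mul]

theorem truncInt_ones (k : ℕ) {ε : ℝ} (hε : ε ∈ Set.Ioc (0 : ℝ) 1) :
    truncInt (List.replicate k (pos 1)) ε = shuffleVar ε ^ k / k.factorial := by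
  have hx : 1 - ε ∈ Set.Ico (0 : ℝ) 1 := ⟨by linarith [hε.2], by linarith [hε.1]⟩
  have h1 := ((hasValue_word 1 (List.replicate 1 (pos 1))).pow k _ hx).2
  have h2 := (hasValue_word 1 (List.replicate k (pos 1)) _ hx).2.mul_left (k.factorial : ℝ)
  rw [← forms_eq_map_word, word_ones, List.replicate_one, ← wordSeries_replicate_one] at h1
  rw [← forms_eq_map_word, word_ones] at h2
  have h3 := h1.unique (h2.congr_fun fun n => ?_)
  · have h4 : truncInt [pos 1] ε ^ k = k.factorial * truncInt (List.replicate k (pos 1)) ε := h3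
    rw [← truncInt_pos_one hε, h4]
    field_simp
  · rw [← nsmul_eq_mul, map_nsmul, nsmul_eq_mul, mul_assoc]

/-- Abel summation gives `S = ε * ∑ F n * (1 - ε) ^ n` with `F` the partial sums of `f`, so decay of
`F` becomes decay of `S` in `ε`. -/
theorem abs_le_of_abs_sum_le {f : ℕ → ℝ} {C : ℝ}
    (hf : ∀ n : ℕ, |∑ k ∈ Finset.range (n + 1), f k| ≤ C / √((n : ℝ) + 1))
    {ε S : ℝ} (hε : ε ∈ Set.Ioc (0 : ℝ) (1 / 2)) (hS : HasSum (fun n => f n * (1 - ε) ^ n) S) :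
    |S| ≤ 5 * C * Real.exp (-(1 / 4 * shuffleVar ε)) := by
  obtain ⟨F, hF⟩ : ∃ F : ℕ → ℝ, F = fun n => ∑ k ∈ Finset.range (n + 1), f k := ⟨_, rfl⟩
  obtain ⟨x, hx⟩ : ∃ x, x = 1 - ε := ⟨_, rfl⟩
  obtain ⟨T, hT⟩ : ∃ T, T = shuffleVar ε := ⟨_, rfl⟩
  rw [← hx] at hS
  rw [← hT]
  have hf' : ∀ n : ℕ, |F n| ≤ C / √((n : ℝ) + 1) := fun n => by rw [hF]; exact hf n
  have hC : 0 ≤ C := by simpa using (abs_nonneg _).trans (hf 0)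
  have hx0 : 0 < x := by linarith [hε.2]
  have hx1 : x < 1 := by linarith [hε.1]
  have hεT : ε = Real.exp (-T) := by
    rw [hT, shuffleVar, neg_neg, Real.exp_log hε.1]
  -- The parameter is `y = ε ^ (1/4)`.
  obtain ⟨y, hy⟩ : ∃ y, y = Real.exp (-(1 / 4 * T)) := ⟨_, rfl⟩
  rw [← hy]
  have hy0 : 0 < y := hy ▸ Real.exp_pos _
  have hy4 : ε = y ^ 4 := by
    rw [hεT, hy, ← Real.exp_nat_mul]
    congr 1
    push_cast
    ring
  -- the geometric and the logarithmic series
  have hgeo : HasSum (fun n : ℕ => x ^ n) ε⁻¹ := by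
    have := hasSum_geometric_of_lt_one hx0.le hx1
    rwa [show 1 - x = ε by linarith] at this
  have hlog : HasSum (fun n : ℕ => x ^ (n + 1) / (n + 1)) T := by
    have := Real.hasSum_pow_div_log_of_abs_lt_one (x := x) (by rwa [abs_of_pos hx0])
    rwa [show 1 - x = ε by linarith, show -Real.log ε = T from hT.symm] at this
  have hbound := (hgeo.mul_left (C * y)).add (hlog.mul_left (2 * C * y⁻¹))
  have hterm : ∀ n : ℕ, |F n * x ^ n| ≤
      C * y * x ^ n + 2 * C * y⁻¹ * (x ^ (n + 1) / (n + 1)) := by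
    intro n
    have hn : (0 : ℝ) < (n : ℝ) + 1 := by positivity
    have hfn := hf' n
    have hr0 : 0 < √((n : ℝ) + 1) := Real.sqrt_pos.mpr hn
    have hr2 : √((n : ℝ) + 1) ^ 2 = n + 1 := Real.sq_sqrt hn.le
    generalize √((n : ℝ) + 1) = r at hfn hr0 hr2
    -- An arithmetic-geometric-mean splitting of `1 / √(n + 1)` into a constant and a multiple of `1
    -- / (n + 1)`, so that the geometric and logarithmic series bound the sum.
    have h1 : 1 / r ≤ y + y⁻¹ * (1 / r ^ 2) := by
      have : y + y⁻¹ * (1 / r ^ 2) - 1 / r = ((y - 1 / r) ^ 2 + y * (1 / r)) / y := by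
        field_simp
        ring
      have h2 : 0 ≤ ((y - 1 / r) ^ 2 + y * (1 / r)) / y := by positivity
      linarith
    have h3 : x ^ n ≤ 2 * x ^ (n + 1) := by
      rw [pow_succ]
      nlinarith [pow_pos hx0 n, hε.2]
    rw [abs_mul, abs_of_pos (pow_pos hx0 n)]
    calc |F n| * x ^ n ≤ C / r * x ^ n := by gcongr
      _ = C * (1 / r) * x ^ n := by ring
      _ ≤ C * (y + y⁻¹ * (1 / r ^ 2)) * x ^ n := by gcongr
      _ = C * y * x ^ n + C * y⁻¹ * (1 / r ^ 2) * x ^ n := by ring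
      _ ≤ C * y * x ^ n + C * y⁻¹ * (1 / r ^ 2) * (2 * x ^ (n + 1)) := by gcongr
      _ = _ := by rw [hr2]; ring
  have habs : Summable fun n => |F n * x ^ n| :=
    Summable.of_nonneg_of_le (fun _ => abs_nonneg _) hterm hbound.summable
  have hFs : HasSum (fun n => F n * x ^ n) (∑' n, F n * x ^ n) := habs.of_abs.hasSum
  have hFle : |∑' n, F n * x ^ n| ≤ C * y * ε⁻¹ + 2 * C * y⁻¹ * T := by
    rw [← Real.norm_eq_abs]
    exact tsum_of_norm_bounded hbound hterm
  have hSF : S = ε * ∑' n, F n * x ^ n := by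
    refine hS.unique ?_
    have h1 := hFs.mul_left x
    have h2 : HasSum (fun n : ℕ => if n = 0 then 0 else F (n - 1) * x ^ n)
        (x * ∑' n, F n * x ^ n) := by
      rw [← hasSum_nat_add_iff' 1]
      simp only [Finset.range_one, Finset.sum_singleton, if_true, sub_zero]
      refine h1.congr_fun fun n => ?_
      simp [pow_succ]
      ring
    have h3 := hFs.sub h2
    rw [show ε * ∑' n, F n * x ^ n = ∑' n, F n * x ^ n - x * ∑' n, F n * x ^ n by
      rw [hx]; ring]
    refine h3.congr_fun fun n => ?_
    rcases n with _ | n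
    · simp [hF]
    · simp only [hF, Nat.succ_ne_zero, if_false, Nat.add_sub_cancel]
      rw [Finset.sum_range_succ _ (n + 1)]
      ring
  -- Since `y ^ 2 = exp (-T / 2)`, this follows from `1 + T / 2 ≤ exp (T / 2)`; it absorbs the
  -- logarithm and yields the constant `1 + 2 * 2 = 5`.
  have hTy : T * y ^ 2 ≤ 2 := by
    have h1 := Real.add_one_le_exp (1 / 2 * T)
    have h2 : y ^ 2 * Real.exp (1 / 2 * T) = 1 := by
      rw [hy, ← Real.exp_nat_mul, ← Real.exp_add, Real.exp_eq_one_iff]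
      push_cast
      ring
    nlinarith [sq_nonneg y]
  rw [hSF, abs_mul, abs_of_pos hε.1]
  calc ε * |∑' n, F n * x ^ n| ≤ ε * (C * y * ε⁻¹ + 2 * C * y⁻¹ * T) := by
        gcongr
        exact hε.1.le
    _ = C * y + 2 * C * y * (T * y ^ 2) := by
        rw [hy4]
        field_simp
    _ ≤ C * y + 2 * C * y * 2 := by gcongr
    _ = _ := by ring

theorem HasExpansion.reg_truncInt {l : List Entry} (hl : IsIndex l) {d : ℕ} {c : ℕ → ℝ}
    (h : HasExpansion (truncSum l) d c) :
    Reg (𝓝[>] 0) shuffleVar (truncInt l)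
      (∑ k ∈ Finset.range (d + 1), C (c k / k.factorial) * X ^ k) := by
  obtain ⟨D, hD⟩ := h
  have h1 : Reg (𝓝[>] 0) shuffleVar (fun ε => truncInt l ε - ∑ k ∈ Finset.range (d + 1),
      c k * truncInt (List.replicate k (pos 1)) ε) 0 := by
    refine reg_zero_of_abs_le tendsto_shuffleVar (δ := 1 / 4) (C := 5 * D) (by norm_num) ?_
    filter_upwards [Ioc_mem_nhdsGT (by norm_num : (0 : ℝ) < 1 / 2)] with ε hε
    have hε' : ε ∈ Set.Ioc (0 : ℝ) 1 := ⟨hε.1, by linarith [hε.2]⟩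
    refine abs_le_of_abs_sum_le (f := fun n => coef l n - ∑ k ∈ Finset.range (d + 1),
      c k * coef (List.replicate k (pos 1)) n) (fun n => ?_) hε ?_
    · have h2 : ∑ m ∈ Finset.range (n + 1), (coef l m - ∑ k ∈ Finset.range (d + 1),
          c k * coef (List.replicate k (pos 1)) m) =
          truncSum l n - ∑ k ∈ Finset.range (d + 1), c k * ones k n := by
        rw [Finset.sum_sub_distrib, sum_range_coef, Finset.sum_comm]
        simp only [← Finset.mul_sum, sum_range_coef, ones]
      rw [h2]
      exact hD n
    · have h3 := (hasSum_truncInt hl hε').sub (hasSum_sum (s := Finset.range (d + 1)) fun k _ =>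
        (hasSum_truncInt (isIndex_ones k) hε').mul_left (c k))
      refine h3.congr_fun fun n => ?_
      rw [sub_mul, Finset.sum_mul]
      simp only [mul_assoc]
  have h2 : Reg (𝓝[>] 0) shuffleVar (fun ε => ∑ k ∈ Finset.range (d + 1),
      c k / k.factorial * shuffleVar ε ^ k)
      (∑ k ∈ Finset.range (d + 1), C (c k / k.factorial) * X ^ k) := by
    refine Reg.sum _ fun k _ => Reg.const_mul _ fun j => ?_
    simp
  have h3 := h1.add h2
  rw [zero_add] at h3
  refine h3.congr ?_
  filter_upwards [Ioc_mem_nhdsGT (one_pos : (0 : ℝ) < 1)] with ε hε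
  have h4 : ∑ k ∈ Finset.range (d + 1), c k * truncInt (List.replicate k (pos 1)) ε =
      ∑ k ∈ Finset.range (d + 1), c k / k.factorial * shuffleVar ε ^ k :=
    Finset.sum_congr rfl fun k _ => by rw [truncInt_ones k hε]; ring
  rw [h4]
  ring

/-! ### The regularized values -/

theorem zetaStar_eq_of_reg {l : List Entry} {P : ℝ[X]}
    (h : Reg atTop stuffleVar (truncSum l) P) : zetaStar l = P := by
  have hP : IsStuffleReg l P := h.tendsto
  have hex : ∃ P, IsStuffleReg l P := ⟨P, hP⟩
  rw [zetaStar, dif_pos hex]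
  exact hex.choose_spec.unique hP

theorem zetaSha_eq_of_reg {l : List Entry} {P : ℝ[X]}
    (h : Reg (𝓝[>] 0) shuffleVar (truncInt l) P) : zetaSha l = P := by
  have hP : IsShuffleReg l P := h.tendsto
  have hex : ∃ P, IsShuffleReg l P := ⟨P, hP⟩
  rw [zetaSha, dif_pos hex]
  exact hex.choose_spec.unique hP

theorem reg_zetaStar {l : List Entry} (hl : IsIndex l) (h3 : l.length ≤ 3) :
    Reg atTop stuffleVar (truncSum l) (zetaStar l) := by
  obtain ⟨c, hc⟩ := exists_hasExpansion l hl
  have h := hc.reg h3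
  rwa [← zetaStar_eq_of_reg h] at h

theorem reg_zetaSha {l : List Entry} (hl : IsIndex l) :
    Reg (𝓝[>] 0) shuffleVar (truncInt l) (zetaSha l) := by
  obtain ⟨c, hc⟩ := exists_hasExpansion l hl
  have h := hc.reg_truncInt hl
  rwa [← zetaSha_eq_of_reg h] at h

theorem zetaStar_of_admissible {l : List Entry} (hl : IsAdmissible l) :
    zetaStar l = C (eulerSum l) :=
  zetaStar_eq_of_reg (reg_truncSum_of_admissible hl)

theorem zetaSha_of_admissible {l : List Entry} (hl : IsAdmissible l) :
    zetaSha l = C (eulerSum l) := by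
  refine zetaSha_eq_of_reg ?_
  simpa using (hasExpansion_of_admissible hl).reg_truncInt hl.1

theorem IsIndex.cons {l : List Entry} (hl : IsIndex l) {e : Entry} (he : 1 ≤ e.1) :
    IsIndex (e :: l) := fun f hf => by
  rcases List.mem_cons.mp hf with rfl | hf
  · exact he
  · exact hl f hf

/-- Only `ones 0` and `ones 1` occur, and both regularizations send them to `1` and `T`. -/
theorem zetaSha_pos_one_cons_of_hasExpansion {l : List Entry} (hl : IsIndex l) {c : ℕ → ℝ}
    (hc : HasExpansion (truncSum l) 0 c) : zetaSha (pos 1 :: l) = zetaStar (pos 1 :: l) := by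
  obtain ⟨c', -, h⟩ := hc.pos_one_cons
  rw [zetaSha_eq_of_reg (h.reg_truncInt (hl.cons le_rfl)), zetaStar_eq_of_reg (h.reg (by norm_num))]
  simp [Finset.sum_range_succ, onesPoly]

theorem zetaSha_pos_one_cons {l : List Entry} (hl : IsAdmissible l) :
    zetaSha (pos 1 :: l) = zetaStar (pos 1 :: l) :=
  zetaSha_pos_one_cons_of_hasExpansion hl.1 (hasExpansion_of_admissible hl)

theorem zetaSha_singleton_one (q : ℤˣ) : zetaSha [(1, q)] = zetaStar [(1, q)] := by
  have hnil : IsIndex [] := by simp [IsIndex]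
  rcases Int.units_eq_one_or q with rfl | rfl
  · exact zetaSha_pos_one_cons_of_hasExpansion (c := fun _ => 1) hnil
      ⟨0, fun n => by simp [truncSum, ones_zero]⟩
  · have h : IsAdmissible [((1, -1) : Entry)] := ⟨hnil.cons le_rfl, by simp, by simp [pos]⟩
    rw [zetaSha_of_admissible h, zetaStar_of_admissible h]

theorem zetaSha_pos_one_pos_one_cons {l : List Entry} (hl : IsAdmissible l) :
    zetaSha (pos 1 :: pos 1 :: l) =
      zetaStar (pos 1 :: pos 1 :: l) + C (1 / 2 * eulerSum [pos 2] * eulerSum l) := by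
  obtain ⟨c', h1, h⟩ := (hasExpansion_of_admissible hl).pos_one_cons
  obtain ⟨c'', h1', h'⟩ := h.pos_one_cons
  -- Only the coefficient of `ones 2` matters: its polynomials `T ^ 2 / 2` and `(T ^ 2 - ζ(2)) / 2`
  -- differ by `ζ(2) / 2`.
  have hc2 : c'' 2 = eulerSum l := by rw [h1', h1]
  rw [zetaSha_eq_of_reg (h'.reg_truncInt ((hl.1.cons le_rfl).cons le_rfl)),
    zetaStar_eq_of_reg (h'.reg (by norm_num))]
  simp only [Finset.sum_range_succ, Finset.sum_range_zero, onesPoly, hc2, div_eq_mul_inv, C_mul]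
  simp [Nat.factorial]
  ring

/-! ### The double shuffle relations -/

/-- The stuffle product of `ζ(1; q)` and `ζ(s; p)`. -/
theorem truncSum_stuffle_one_one (q z : ℤˣ) (s n : ℕ) :
    truncSum [(1, q)] n * truncSum [(s, z)] n =
      truncSum [(1, q), (s, z)] n + truncSum [(s, z), (1, q)] n + truncSum [(s + 1, q * z)] n := by
  induction n with
  | zero => simp [truncSum]
  | succ n ih =>
    simp only [truncSum_succ _ n, coef_cons_succ]
    simp only [show truncSum [] n = 1 from rfl, Units.val_mul, Int.cast_mul, mul_pow, pow_succ
      ((n : ℝ) + 1), pow_zero, one_mul, mul_one]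
    have : (n : ℝ) + 1 ≠ 0 := by positivity
    field_simp
    linear_combination ((n : ℝ) + 1) * ((n : ℝ) + 1) ^ s * ih

/-- The stuffle product of `ζ(1; q)` and `ζ(1, s; p, z)`. -/
theorem truncSum_stuffle_one_two (q p z : ℤˣ) (s n : ℕ) :
    truncSum [(1, q)] n * truncSum [(1, p), (s, z)] n =
      truncSum [(1, q), (1, p), (s, z)] n + truncSum [(1, p), (1, q), (s, z)] n
      + truncSum [(1, p), (s, z), (1, q)] n + truncSum [(2, q * p), (s, z)] n
      + truncSum [(1, p), (s + 1, q * z)] n := by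
  induction n with
  | zero => simp [truncSum]
  | succ n ih =>
    have h := truncSum_stuffle_one_one q z s n
    rw [truncSum_succ [(1, q)], truncSum_succ [(1, p), (s, z)], truncSum_succ [(1, q), _, _],
      truncSum_succ [(1, p), (1, q), _], truncSum_succ [(1, p), (s, z), _],
      truncSum_succ [(2, _), _], truncSum_succ [(1, p), (s + 1, _)]]
    simp only [coef_cons_succ]
    simp only [show truncSum [] n = 1 from rfl, Units.val_mul, Int.cast_mul, mul_pow,
      pow_one, mul_one, div_eq_mul_inv, mul_inv, pow_two]
    -- In the increment of the product, the term where only the second factor advances contains a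
    -- depth-one product, expanded by `h`.
    linear_combination ih + ((p : ℤ) : ℝ) ^ (n + 1) / ((n : ℝ) + 1) * h

theorem zetaStar_stuffle (q p z : ℤˣ) {s : ℕ} (hs : 1 ≤ s) :
    zetaStar [(1, q)] * zetaStar [(1, p), (s, z)] =
      zetaStar [(1, q), (1, p), (s, z)] + zetaStar [(1, p), (1, q), (s, z)]
      + zetaStar [(1, p), (s, z), (1, q)] + zetaStar [(2, q * p), (s, z)]
      + zetaStar [(1, p), (s + 1, q * z)] := by
  have h (l : List Entry) (hl : ∀ e ∈ l, 1 ≤ e.1) (h3 : l.length ≤ 3) := reg_zetaStar hl h3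
  refine Reg.unique tendsto_stuffleVar ((h _ ?_ ?_).mul (h _ ?_ ?_)) ?_
  any_goals simp [hs]
  simp only [truncSum_stuffle_one_two]
  refine ((((h _ ?_ ?_).add (h _ ?_ ?_)).add (h _ ?_ ?_)).add (h _ ?_ ?_)).add (h _ ?_ ?_)
  all_goals simp [hs]

theorem sum_pairs {β : Type*} [AddCommMonoid β] (k : ℕ) (f : ℕ × ℕ → β) :
    ∑ x ∈ pairs (k + 2), f x = ∑ i ∈ Finset.range (k + 1), f (i + 1, k - i + 1) := by
  symm
  refine Finset.sum_bij (fun i _ => (i + 1, k - i + 1)) ?_ ?_ ?_ fun _ _ => rfl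
  · intro i hi
    have := Finset.mem_range.mp hi
    simp only [pairs, Finset.mem_filter, Finset.HasAntidiagonal.mem_antidiagonal]
    omega
  · intro i _ j _ hij
    simpa using congrArg Prod.fst hij
  · rintro ⟨b, c⟩ hbc
    simp only [pairs, Finset.mem_filter, Finset.HasAntidiagonal.mem_antidiagonal] at hbc
    refine ⟨b - 1, Finset.mem_range.mpr (by omega), ?_⟩
    ext <;> simp <;> omega

/-- The sum formula for truncated iterated integrals, from the shuffle product. -/
theorem sum_truncInt (p q r : ℤˣ) (k : ℕ) {ε : ℝ} (hε : ε ∈ Set.Ioc (0 : ℝ) 1) :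
    truncInt [(1, q)] ε * truncInt [(1, p), (k + 1, p * r)] ε =
      ∑ i ∈ Finset.range (k + 1), truncInt [(1, p), (i + 1, p * q), (k - i + 1, q * r)] ε
      + truncInt [(1, p), (k + 1, p * r), (1, q * r)] ε
      + truncInt [(1, q), (1, q * p), (k + 1, p * r)] ε := by
  have hx : 1 - ε ∈ Set.Ico (0 : ℝ) 1 := ⟨by linarith [hε.2], by linarith [hε.1]⟩
  have hv : ∀ l : List Entry, HasSum
      (fun n => PowerSeries.coeff n (wordSeries (word 1 l)) * (1 - ε) ^ n) (truncInt l ε) := by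
    intro l
    have := (hasValue_word 1 l _ hx).2
    rwa [← forms_eq_map_word] at this
  have hmul : ∀ a b : ℤˣ, a * (a * b) = b := fun a b => by
    rw [← mul_assoc, Int.units_mul_self, one_mul]
  have hmul' : ∀ a b : ℤˣ, a * (b * a) = b := fun a b => by
    rw [mul_left_comm, Int.units_mul_self, mul_one]
  have h1 := ((hasValue_word 1 [(1, q)]).mul (hasValue_word 1 [(1, p), (k + 1, p * r)]) _ hx).2
  rw [← forms_eq_map_word, ← forms_eq_map_word] at h1
  refine h1.unique ?_
  have h2 := ((hasSum_sum (s := Finset.range (k + 1)) fun i _ =>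
    hv [(1, p), (i + 1, p * q), (k - i + 1, q * r)]).add
      (hv [(1, p), (k + 1, p * r), (1, q * r)])).add (hv [(1, q), (1, q * p), (k + 1, p * r)])
  refine h2.congr_fun fun n => ?_
  have h3 := wordSeries_sum_formula p q r k
  -- Signs square to `1`, so the partial products of the signs collapse to the bare letters `p`,
  -- `q`, `r`.
  simp only [word, one_mul, hmul, hmul', Nat.add_sub_cancel, Nat.sub_self, List.replicate_zero,
    List.nil_append]
  rw [h3]
  simp only [map_add, map_sum, add_mul, Finset.sum_mul]

theorem sum_zetaSha (p q r : ℤˣ) (k : ℕ) :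
    ∑ x ∈ pairs (k + 2), zetaSha [(1, p), (x.1, p * q), (x.2, q * r)] =
      zetaSha [(1, q)] * zetaSha [(1, p), (k + 1, p * r)]
      - zetaSha [(1, p), (k + 1, p * r), (1, q * r)]
      - zetaSha [(1, q), (1, q * p), (k + 1, p * r)] := by
  rw [sum_pairs]
  have h (l : List Entry) (hl : ∀ e ∈ l, 1 ≤ e.1) := reg_zetaSha hl
  refine Reg.unique tendsto_shuffleVar (Reg.sum _ fun i _ => h _ ?_)
    (Reg.congr ((((h _ ?_).mul (h _ ?_)).sub (h _ ?_)).sub (h _ ?_)) ?_)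
  any_goals simp
  filter_upwards [Ioc_mem_nhdsGT (one_pos : (0 : ℝ) < 1)] with ε hε
  rw [sum_truncInt p q r k hε]
  ring

theorem isAdmissible_cons {s : ℕ} {z : ℤˣ} {l : List Entry} (hs : 1 ≤ s)
    (hz : 2 ≤ s ∨ z = -1) (hl : ∀ e ∈ l, 1 ≤ e.1) : IsAdmissible ((s, z) :: l) := by
  refine ⟨IsIndex.cons hl hs, by simp, ?_⟩
  rcases hz with hz | rfl
  · simp [pos]
    omega
  · simp [pos]

theorem zetaSha_one_cons {p z : ℤˣ} {s : ℕ} (hs : 2 ≤ s) :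
    zetaSha [(1, p), (s, z)] = zetaStar [(1, p), (s, z)] := by
  have h1 : IsAdmissible [(s, z)] := isAdmissible_cons (by omega) (Or.inl hs) (by simp)
  rcases Int.units_eq_one_or p with rfl | rfl
  · exact zetaSha_pos_one_cons h1
  · have h : IsAdmissible [(1, -1), (s, z)] :=
      isAdmissible_cons le_rfl (Or.inr rfl) h1.1
    rw [zetaSha_of_admissible h, zetaStar_of_admissible h]

/-- The sum formula with arbitrary signs, from the double shuffle relations. -/
theorem sum_zetaSha_eq (p q r : ℤˣ) {u : ℕ} (hu : 2 ≤ u) :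
    ∑ x ∈ pairs (u + 1), zetaSha [(1, p), (x.1, p * q), (x.2, q * r)] =
      zetaStar [(1, q), (1, p), (u, p * r)] + zetaStar [(1, p), (1, q), (u, p * r)]
      + zetaStar [(1, p), (u, p * r), (1, q)] + C (eulerSum [(2, q * p), (u, p * r)])
      + zetaStar [(1, p), (u + 1, q * (p * r))]
      - zetaSha [(1, p), (u, p * r), (1, q * r)]
      - zetaSha [(1, q), (1, q * p), (u, p * r)] := by
  obtain ⟨k, rfl⟩ : ∃ k, u = k + 1 := ⟨u - 1, by omega⟩
  rw [sum_zetaSha, zetaSha_singleton_one, zetaSha_one_cons hu, zetaStar_stuffle _ _ _ (by omega),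
    ← zetaStar_of_admissible (l := [(2, q * p), (k + 1, p * r)])]
  exact isAdmissible_cons (by norm_num) (Or.inl le_rfl) (by simp)

/-- The sum formula for admissible indices. -/
theorem sum_eulerSum_eq (q r : ℤˣ) {u : ℕ} (hu : 2 ≤ u) :
    C (∑ x ∈ pairs (u + 1), eulerSum [(1, -1), (x.1, -q), (x.2, q * r)]) =
      zetaStar [(1, q), (1, -1), (u, -r)] + C (eulerSum [(1, -1), (1, q), (u, -r)])
      + C (eulerSum [(1, -1), (u, -r), (1, q)]) + C (eulerSum [(2, -q), (u, -r)])
      + C (eulerSum [(1, -1), (u + 1, -(q * r))])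
      - C (eulerSum [(1, -1), (u, -r), (1, q * r)])
      - zetaSha [(1, q), (1, -q), (u, -r)] := by
  have h := sum_zetaSha_eq (-1) q r hu
  have hadm : ∀ l : List Entry, (∀ e ∈ l, 1 ≤ e.1) → IsAdmissible ((1, -1) :: l) :=
    fun l hl => isAdmissible_cons le_rfl (Or.inr rfl) hl
  rw [Finset.sum_congr rfl fun x hx => zetaSha_of_admissible (hadm _ ?_)] at h
  · rw [map_sum]
    simp only [neg_one_mul, mul_neg] at h
    rw [h, zetaStar_of_admissible (hadm [(1, q), (u, -r)] ?_),
      zetaStar_of_admissible (hadm [(u, -r), (1, q)] ?_),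
      zetaStar_of_admissible (hadm [(u + 1, -(q * r))] ?_),
      zetaSha_of_admissible (hadm [(u, -r), (1, q * r)] ?_)]
    all_goals simp
    all_goals omega
  · simp only [pairs, Finset.mem_filter] at hx
    simp [hx.2.1, hx.2.2]

end EulerSums

/-! ### The eight choices of signs -/

theorem mainTheorem11 :
    -- the values below exist: the series converge and the regularizations are as specified
    (∀ l : List Entry, IsAdmissible l → l.length ≤ 3 →
      Tendsto (truncSum l) atTop (𝓝 (eulerSum l))) ∧
    (∀ l : List Entry, IsIndex l → l.length ≤ 3 →
      IsStuffleReg l (zetaStar l) ∧ IsShuffleReg l (zetaSha l)) ∧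
    -- the eight sum formulas
    (∀ w u v : ℕ, 4 ≤ w → u + 2 = w → v + 1 = w →
      (∑ p ∈ pairs (w - 1), zetaSha [pos 1, pos p.1, pos p.2]
          = C (eulerSum [pos 2, pos u]) + zetaStar [pos 1, pos v]
            + zetaStar [pos 1, pos 1, pos u]
            - C (1 / 2 * eulerSum [pos 2] * eulerSum [pos u])) ∧
      (∑ p ∈ pairs (w - 1), zetaSha [pos 1, bar p.1, pos p.2]
          = C (eulerSum [bar 2, bar u]) + zetaStar [pos 1, pos v]
            + zetaStar [pos 1, bar 1, bar u] + zetaStar [pos 1, bar u, bar 1]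
            + C (eulerSum [bar 1, pos 1, bar u]) - C (eulerSum [bar 1, bar 1, bar u])
            - zetaStar [pos 1, bar u, pos 1]) ∧
      (∑ p ∈ pairs (w - 1), eulerSum [bar 1, pos p.1, pos p.2]
          = eulerSum [pos 2, pos u] + eulerSum [bar 1, bar v]
            + eulerSum [bar 1, pos u, bar 1] + 2 * eulerSum [bar 1, bar 1, pos u]
            - eulerSum [bar 1, pos 1, pos u] - eulerSum [bar 1, pos u, pos 1]) ∧
      (∑ p ∈ pairs (w - 1), eulerSum [bar 1, bar p.1, pos p.2]
          = eulerSum [bar 2, bar u] + eulerSum [bar 1, bar v]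
            + eulerSum [bar 1, pos 1, bar u]) ∧
      (∑ p ∈ pairs (w - 1), eulerSum [bar 1, bar p.1, bar p.2]
          = eulerSum [bar 2, pos u] + eulerSum [bar 1, pos v]
            + eulerSum [bar 1, pos u, pos 1] + eulerSum [bar 1, pos 1, pos u]
            - eulerSum [bar 1, pos u, bar 1]) ∧
      (∑ p ∈ pairs (w - 1), zetaSha [pos 1, pos p.1, bar p.2]
          = C (eulerSum [pos 2, bar u]) + zetaStar [pos 1, bar v]
            + zetaStar [pos 1, bar u, pos 1] + zetaStar [pos 1, pos 1, bar u]
            - zetaSha [pos 1, bar u, bar 1]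
            - C (1 / 2 * eulerSum [pos 2] * eulerSum [bar u])) ∧
      (∑ p ∈ pairs (w - 1), zetaSha [pos 1, bar p.1, bar p.2]
          = C (eulerSum [bar 2, pos u]) + zetaStar [pos 1, bar v]
            + zetaStar [pos 1, bar 1, pos u] + C (eulerSum [bar 1, pos 1, pos u])
            - C (eulerSum [bar 1, bar 1, pos u])) ∧
      (∑ p ∈ pairs (w - 1), eulerSum [bar 1, pos p.1, bar p.2]
          = eulerSum [pos 2, bar u] + eulerSum [bar 1, pos v]
            + 2 * eulerSum [bar 1, bar 1, bar u] - eulerSum [bar 1, pos 1, bar u])) := by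
  refine ⟨fun l hl _ => tendsto_truncSum hl, fun l hl h3 =>
    ⟨(reg_zetaStar hl h3).tendsto, (reg_zetaSha hl).tendsto⟩, ?_⟩
  rintro w u v hw hu rfl
  obtain rfl : v = u + 1 := by omega
  have hu2 : 2 ≤ u := by omega
  have hmm : (-1 : ℤˣ) * -1 = 1 := by decide
  have hs : ∀ z : ℤˣ, IsAdmissible [(u, z)] := fun z =>
    isAdmissible_cons (by omega) (Or.inl hu2) (by simp)
  have hb : ∀ e f : Entry, 1 ≤ e.1 → 1 ≤ f.1 → IsAdmissible [(1, -1), e, f] := fun e f he hf =>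
    isAdmissible_cons le_rfl (Or.inr rfl) (by simp [he, hf])
  have hp : ∀ (z : ℤˣ) (e : Entry), 1 ≤ e.1 → IsAdmissible [(u, z), e] := fun z e he =>
    isAdmissible_cons (by omega) (Or.inl hu2) (by simp [he])
  have hn : ∀ z : ℤˣ, IsAdmissible [(1, -1), (u, z)] := fun z =>
    isAdmissible_cons le_rfl (Or.inr rfl) (by simp; omega)
  have hu1 : 1 ≤ u := by omega
  -- Shuffle values are converted to stuffle values: no correction when a single unbarred `1` leads
  -- (`s1`, `s2`), and a `ζ(2)` correction when two lead (`s3`).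
  have s1 := fun z e he => zetaSha_pos_one_cons (hp z e he)
  have s2 := fun z => zetaSha_pos_one_cons (hn z)
  have s3 := fun z => zetaSha_pos_one_pos_one_cons (hs z)
  have a1 := fun e f he hf => zetaSha_of_admissible (hb e f he hf)
  have a2 := fun e f he hf => zetaStar_of_admissible (hb e f he hf)
  simp only [pos, bar, Nat.add_sub_cancel] at s1 s2 s3 ⊢
  refine ⟨?_, ?_, ?_, ?_, ?_, ?_, ?_, ?_⟩
  · have h := sum_zetaSha_eq 1 1 1 hu2
    simp only [mul_one] at h
    rw [h, s1 _ _ le_rfl, s3]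
    ring
  · have h := sum_zetaSha_eq 1 (-1) (-1) hu2
    simp only [mul_one, one_mul, hmm] at h
    rw [h, s1 _ _ le_rfl, a1 _ _ le_rfl hu1, a2 _ _ le_rfl hu1]
    ring
  · have h := sum_eulerSum_eq (-1) (-1) hu2
    simp only [neg_neg, hmm] at h
    rw [a1 _ _ le_rfl hu1, a2 _ _ le_rfl hu1] at h
    -- For `p = -1` the sum is over admissible indices, so the identity of constant polynomials
    -- descends to real numbers.
    refine C_injective (h.trans ?_)
    simp only [C_add, C_sub, C_mul, C_ofNat]
    ring
  · have h := sum_eulerSum_eq 1 1 hu2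
    simp only [mul_one] at h
    rw [s2] at h
    refine C_injective (h.trans ?_)
    simp only [C_add]
    ring
  · have h := sum_eulerSum_eq 1 (-1) hu2
    simp only [neg_neg, one_mul] at h
    rw [s2] at h
    refine C_injective (h.trans ?_)
    simp only [C_add, C_sub]
    ring
  · have h := sum_zetaSha_eq 1 1 (-1) hu2
    simp only [mul_one, one_mul] at h
    rw [h, s3]
    ring
  · have h := sum_zetaSha_eq 1 (-1) 1 hu2
    simp only [mul_one, one_mul] at h
    rw [h, s1 _ _ le_rfl, a1 _ _ le_rfl hu1, a2 _ _ le_rfl hu1]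
    ring
  · have h := sum_eulerSum_eq (-1) 1 hu2
    simp only [neg_neg, mul_one] at h
    rw [a1 _ _ le_rfl hu1, a2 _ _ le_rfl hu1] at h
    refine C_injective (h.trans ?_)
    simp only [C_add, C_sub, C_mul, C_ofNat]
    ring
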